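/- **Proposition 3.2.** Let $\mathcal A$ and $\mathcal B$ be (not necessarily unital) complex C$^*$-algebras. Suppose that $\mathcal A$ is a separable quasidiagonal C$^*$-algebra, i.e. $\mathcal A$ is separable and there are a faithful $*$-representation $\pi:\mathcal A\to B(\mathcal H)$ on a Hilbert space $\mathcal H$ and an increasing sequence $\{p_i\}_{i=1}^\infty$ of finite-rank projections on $\mathcal H$, tending strongly to the identity, such that $\|\pi(x)p_i-p_i\pi(x)\|\to 0$ as $i\to\infty$ for every $x\in\mathcal A$. Suppose that $\mathcal B$ is an MF algebra, where a C$^*$-algebra $\mathcal C$ is called an MF algebra if it is separable and there is an embedding (an injective $*$-homomorphism) of $\mathcal C$ into $\prod_k \mathcal M_{n_k}(\mathbb C)/\sum_k \mathcal M_{n_k}(\mathbb C)$ for some sequence of positive integers $\{n_k\}_{k=1}^\infty$; here $\mathcal M_n(\mathbb C)$ is the C$^*$-algebra of $n\times n$ complex matrices, $\prod_k \mathcal M_{n_k}(\mathbb C)$ is the C$^*$-algebra of norm-bounded sequences with the supremum norm, and $\sum_k \mathcal M_{n_k}(\mathbb C)$ is its ideal of sequences whose norms tend to $0$. Then the minimal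 (spatial) tensor product $\mathcal A\otimes_{\min}\mathcal B$ is an MF algebra. Here $\mathcal A\otimes_{\min}\mathcal B$ is the completion of the algebraic tensor product $\mathcal A\odot\mathcal B$ in the norm $$\Big\|\sum_j a_j\otimes b_j\Big\|_{\min}=\sup_{\sigma,\rho}\Big\|\sum_j \sigma(a_j)\otimes\rho(b_j)\Big\|_{B(\mathcal H_\sigma\otimes\mathcal H_\rho)},$$ the supremum being over all $*$-representations $\sigma$ of $\mathcal A$ and $\rho$ of $\mathcal B$ on Hilbert spaces $\mathcal H_\sigma$, $\mathcal H_\rho$, with $\mathcal H_\sigma\otimes\mathcal H_\rho$ the Hilbert space tensor product (the supremum is attained at any pair of faithful representations). -/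

import Mathlib

open Filter Topology
open scoped ENNReal TensorProduct Matrix.Norms.L2Operator

universe u v

noncomputable section

/-! ### The C*-algebras `∏ₖ Aₖ` and `∏ₖ Aₖ / ∑ₖ Aₖ`

The C*-algebra `∏ₖ Aₖ` of bounded sequences with the supremum norm is `lp A ∞`. -/

section ProdModSum

variable (A : ℕ → Type u) [∀ k, NonUnitalCStarAlgebra (A k)]

/-- The ideal `∑ₖ Aₖ` of `∏ₖ Aₖ`: the sequences whose norms tend to `0`. -/
def sumIdeal : Submodule ℂ (lp A ∞) where
  carrier := {x | Tendsto (fun k => ‖x k‖) atTop (𝓝 0)}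
  zero_mem' := by simp
  add_mem' {x y} hx hy :=
    squeeze_zero (fun k => norm_nonneg _) (fun k => norm_add_le (x k) (y k))
      (by simpa using Tendsto.add hx hy)
  smul_mem' c x hx := by
    have h : Tendsto (fun k => ‖c‖ * ‖x k‖) atTop (𝓝 0) := by
      simpa using Tendsto.const_mul ‖c‖ hx
    simpa [norm_smul] using h

variable {A}

lemma mem_sumIdeal {x : lp A ∞} :
    x ∈ sumIdeal A ↔ Tendsto (fun k => ‖x k‖) atTop (𝓝 0) := Iff.rfl

lemma sumIdeal_mul_left (y : lp A ∞) {x : lp A ∞} (hx : x ∈ sumIdeal A) :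
    y * x ∈ sumIdeal A := by
  rw [mem_sumIdeal] at *
  refine squeeze_zero (fun k => norm_nonneg _) (fun k => ?_)
    (by simpa using Tendsto.const_mul ‖y‖ hx)
  rw [lp.infty_coeFn_mul, Pi.mul_apply]
  exact (norm_mul_le _ _).trans
    (mul_le_mul_of_nonneg_right (lp.norm_apply_le_norm ENNReal.top_ne_zero y k) (norm_nonneg _))

lemma sumIdeal_mul_right (y : lp A ∞) {x : lp A ∞} (hx : x ∈ sumIdeal A) :
    x * y ∈ sumIdeal A := by
  rw [mem_sumIdeal] at *
  refine squeeze_zero (fun k => norm_nonneg _) (fun k => ?_)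
    (by simpa using Tendsto.mul_const ‖y‖ hx)
  rw [lp.infty_coeFn_mul, Pi.mul_apply]
  exact (norm_mul_le _ _).trans
    (mul_le_mul_of_nonneg_left (lp.norm_apply_le_norm ENNReal.top_ne_zero y k) (norm_nonneg _))

lemma sumIdeal_star {x : lp A ∞} (hx : x ∈ sumIdeal A) : star x ∈ sumIdeal A := by
  rw [mem_sumIdeal] at *
  simpa [lp.star_apply] using hx

instance isClosed_sumIdeal : IsClosed (sumIdeal A : Set (lp A ∞)) := by
  refine isClosed_of_closure_subset fun x hx => ?_
  rw [SetLike.mem_coe, mem_sumIdeal, Metric.tendsto_atTop]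
  intro ε hε
  obtain ⟨y, hy, hxy⟩ := Metric.mem_closure_iff.1 hx (ε / 2) (by positivity)
  obtain ⟨N, hN⟩ := Metric.tendsto_atTop.1 (mem_sumIdeal.1 hy) (ε / 2) (by positivity)
  refine ⟨N, fun k hk => ?_⟩
  have h1 := hN k hk
  have h2 : ‖(x - y) k‖ ≤ ‖x - y‖ := lp.norm_apply_le_norm ENNReal.top_ne_zero _ k
  rw [lp.coeFn_sub, Pi.sub_apply] at h2
  rw [dist_eq_norm] at hxy
  have h3 := norm_le_norm_add_norm_sub' (x k) (y k)
  simp only [dist_zero_right, norm_norm] at h1 ⊢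
  linarith

variable (A) in
/-- The quotient `∏ₖ Aₖ / ∑ₖ Aₖ`. Its linear structure and its quotient norm are the ones of the
quotient by the closed subspace `∑ₖ Aₖ`. -/
def ProdModSum : Type u := lp A ∞ ⧸ sumIdeal A

namespace ProdModSum

instance : NormedAddCommGroup (ProdModSum A) :=
  inferInstanceAs (NormedAddCommGroup (lp A ∞ ⧸ sumIdeal A))

instance : NormedSpace ℂ (ProdModSum A) :=
  inferInstanceAs (NormedSpace ℂ (lp A ∞ ⧸ sumIdeal A))

instance : CompleteSpace (ProdModSum A) :=
  inferInstanceAs (CompleteSpace (lp A ∞ ⧸ sumIdeal A))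

variable (A) in
/-- The canonical quotient map `∏ₖ Aₖ → ∏ₖ Aₖ / ∑ₖ Aₖ`, `⟨xₖ⟩ ↦ [⟨xₖ⟩]`. -/
def mk : lp A ∞ →ₗ[ℂ] ProdModSum A := (sumIdeal A).mkQ

lemma mk_surjective : Function.Surjective (mk A) := (sumIdeal A).mkQ_surjective

lemma mk_eq_mk {x y : lp A ∞} : mk A x = mk A y ↔ x - y ∈ sumIdeal A :=
  Submodule.Quotient.eq (sumIdeal A)

/-- Multiplication of classes: `[x] [y] = [x y]`. -/
instance : Mul (ProdModSum A) where
  mul := Quotient.map₂ (· * ·) fun x x' hx y y' hy => by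
    have hx' : x - x' ∈ sumIdeal A := (sumIdeal A).quotientRel_def.1 hx
    have hy' : y - y' ∈ sumIdeal A := (sumIdeal A).quotientRel_def.1 hy
    refine (sumIdeal A).quotientRel_def.2 ?_
    have h := (sumIdeal A).add_mem (sumIdeal_mul_right y hx') (sumIdeal_mul_left x' hy')
    have e : x * y - x' * y' = (x - x') * y + x' * (y - y') := by noncomm_ring
    rwa [e]

/-- The involution on classes: `[x]* = [x*]`. -/
instance : Star (ProdModSum A) where
  star := Quotient.map star fun x x' hx => by
    have hx' : x - x' ∈ sumIdeal A := (sumIdeal A).quotientRel_def.1 hx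
    refine (sumIdeal A).quotientRel_def.2 ?_
    rw [← star_sub]
    exact sumIdeal_star hx'

lemma mk_mul (x y : lp A ∞) : mk A (x * y) = mk A x * mk A y := rfl

lemma mk_star (x : lp A ∞) : mk A (star x) = star (mk A x) := rfl

/-- The quotient norm of `[x]` is at most every eventual bound of `‖xₖ‖`. -/
lemma norm_mk_le_of_eventually {x : lp A ∞} {r : ℝ} (hr : 0 ≤ r)
    (h : ∀ᶠ k in atTop, ‖x k‖ ≤ r) : ‖mk A x‖ ≤ r := by
  obtain ⟨N, hN⟩ := eventually_atTop.1 h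
  let f : ∀ k, A k := fun k => if k < N then 0 else x k
  have hf : ∀ k, ‖f k‖ ≤ r := fun k => by
    by_cases hk : k < N
    · simpa [f, hk] using hr
    · simpa [f, hk] using hN k (not_lt.1 hk)
  let y : lp A ∞ := ⟨f, memℓp_infty ⟨r, by rintro _ ⟨k, rfl⟩; exact hf k⟩⟩
  have hxy : mk A x = mk A y := by
    rw [mk_eq_mk, mem_sumIdeal]
    refine tendsto_const_nhds.congr' ?_
    filter_upwards [eventually_ge_atTop N] with k hk
    have h0 : f k = x k := by simp [f, not_lt.2 hk]
    have h1 : (x - y) k = 0 := by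
      rw [lp.coeFn_sub, Pi.sub_apply]
      exact sub_eq_zero.2 h0.symm
    rw [h1, norm_zero]
  rw [hxy]
  exact (Submodule.Quotient.norm_mk_le (S := sumIdeal A) y).trans
    (lp.norm_le_of_forall_le hr hf)

/-- Eventually `‖xₖ‖` is at most the quotient norm of `[x]` up to `ε`. -/
lemma eventually_norm_le (x : lp A ∞) {ε : ℝ} (hε : 0 < ε) :
    ∀ᶠ k in atTop, ‖x k‖ ≤ ‖mk A x‖ + ε := by
  obtain ⟨m, hm, hm'⟩ :=
    Submodule.Quotient.norm_mk_lt (S := sumIdeal A) (mk A x) (half_pos hε)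
  have hm' : ‖m‖ < ‖mk A x‖ + ε / 2 := hm'
  have hmx : x - m ∈ sumIdeal A := mk_eq_mk.1 hm.symm
  filter_upwards [(mem_sumIdeal.1 hmx).eventually (gt_mem_nhds (half_pos hε))] with k hk
  have h1 : ‖m k‖ ≤ ‖m‖ := lp.norm_apply_le_norm ENNReal.top_ne_zero m k
  have h2 := norm_le_norm_add_norm_sub' (x k) (m k)
  rw [lp.coeFn_sub, Pi.sub_apply] at hk
  linarith

lemma ind {p : ProdModSum A → Prop} (h : ∀ x, p (mk A x)) (z : ProdModSum A) : p z := by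
  obtain ⟨x, rfl⟩ := mk_surjective z
  exact h x

instance : NonUnitalNormedRing (ProdModSum A) where
  __ := (inferInstance : NormedAddCommGroup (ProdModSum A))
  left_distrib := ind fun x => ind fun y => ind fun z => congrArg (mk A) (mul_add x y z)
  right_distrib := ind fun x => ind fun y => ind fun z => congrArg (mk A) (add_mul x y z)
  zero_mul := ind fun x => congrArg (mk A) (zero_mul x)
  mul_zero := ind fun x => congrArg (mk A) (mul_zero x)
  mul_assoc := ind fun x => ind fun y => ind fun z => congrArg (mk A) (mul_assoc x y z)
  norm_mul_le := ind fun x => ind fun y => by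
    have key : ∀ ε : ℝ, 0 < ε →
        ‖mk A (x * y)‖ ≤ (‖mk A x‖ + ε) * (‖mk A y‖ + ε) := fun ε hε => by
      refine norm_mk_le_of_eventually (by positivity) ?_
      filter_upwards [eventually_norm_le x hε, eventually_norm_le y hε] with k h1 h2
      rw [lp.infty_coeFn_mul, Pi.mul_apply]
      exact (norm_mul_le _ _).trans (mul_le_mul h1 h2 (norm_nonneg _) (by positivity))
    have hlim : Tendsto (fun ε : ℝ => (‖mk A x‖ + ε) * (‖mk A y‖ + ε)) (𝓝[>] 0)
        (𝓝 (‖mk A x‖ * ‖mk A y‖)) := by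
      have : Continuous fun ε : ℝ => (‖mk A x‖ + ε) * (‖mk A y‖ + ε) := by fun_prop
      simpa using (this.tendsto 0).mono_left nhdsWithin_le_nhds
    exact ge_of_tendsto hlim (eventually_mem_nhdsWithin.mono fun ε hε => key ε hε)

instance : StarRing (ProdModSum A) where
  star_involutive := ind fun x => congrArg (mk A) (star_star x)
  star_mul := ind fun x => ind fun y => congrArg (mk A) (star_mul x y)
  star_add := ind fun x => ind fun y => congrArg (mk A) (star_add x y)

instance : CStarRing (ProdModSum A) where
  norm_mul_self_le := ind fun x => by
    rw [← mk_star, ← mk_mul]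
    refine le_of_forall_pos_le_add fun ε hε => ?_
    have h : ‖mk A x‖ ≤ √(‖mk A (star x * x)‖ + ε) := by
      refine norm_mk_le_of_eventually (Real.sqrt_nonneg _) ?_
      filter_upwards [eventually_norm_le (star x * x) hε] with k hk
      rw [lp.infty_coeFn_mul, Pi.mul_apply, lp.star_apply, CStarRing.norm_star_mul_self] at hk
      exact Real.le_sqrt_of_sq_le (by rwa [sq])
    rw [← sq]
    exact (Real.le_sqrt (norm_nonneg _) (by positivity)).1 h

instance : IsScalarTower ℂ (ProdModSum A) (ProdModSum A) where
  smul_assoc c := ind fun x => ind fun y => congrArg (mk A) (smul_mul_assoc c x y)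

instance : SMulCommClass ℂ (ProdModSum A) (ProdModSum A) where
  smul_comm c := ind fun x => ind fun y => congrArg (mk A) (mul_smul_comm c x y).symm

instance : StarModule ℂ (ProdModSum A) where
  star_smul c := ind fun x => congrArg (mk A) (star_smul c x)

instance : NonUnitalCStarAlgebra (ProdModSum A) where

end ProdModSum

end ProdModSum

/-! ### MF algebras -/

/-- An MF algebra: a separable C*-algebra with an embedding (an injective `*`-homomorphism) into
`∏ₖ M_{nₖ}(ℂ) / ∑ₖ M_{nₖ}(ℂ)` for some sequence of positive integers `nₖ`. Here `Mₙ(ℂ)` carries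
the operator norm. -/
def IsMF (A : Type u) [NonUnitalCStarAlgebra A] : Prop :=
  TopologicalSpace.SeparableSpace A ∧
    ∃ n : ℕ → ℕ, (∀ k, 0 < n k) ∧
      ∃ φ : A →⋆ₙₐ[ℂ] ProdModSum (fun k => Matrix (Fin (n k)) (Fin (n k)) ℂ),
        Function.Injective φ

/-! ### Quasidiagonal C*-algebras -/

/-- A set `S` of bounded operators on a Hilbert space is quasidiagonal if there is an increasing
sequence of finite-rank (orthogonal) projections tending strongly to the identity and commuting
asymptotically in norm with each member of `S`. -/
def IsQuasidiagonalSet {H : Type u} [NormedAddCommGroup H] [InnerProductSpace ℂ H]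
    [CompleteSpace H] (S : Set (H →L[ℂ] H)) : Prop :=
  ∃ p : ℕ → H →L[ℂ] H,
    (∀ i, IsStarProjection (p i)) ∧
    (∀ i, FiniteDimensional ℂ (p i).range) ∧
    Monotone p ∧
    (∀ ξ : H, Tendsto (fun i => p i ξ) atTop (𝓝 ξ)) ∧
    ∀ x ∈ S, Tendsto (fun i => ‖x * p i - p i * x‖) atTop (𝓝 0)

/-- An abstract separable C*-algebra `A` is quasidiagonal if it has a faithful `*`-representation
`π` on a Hilbert space `H` such that `π(A)` is a quasidiagonal set of operators. (The projections
force `H` to be separable, so the universe of `H` is immaterial.) -/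
def IsQuasidiagonal (A : Type u) [NonUnitalCStarAlgebra A] : Prop :=
  TopologicalSpace.SeparableSpace A ∧
    ∃ (H : Type u) (_ : NormedAddCommGroup H) (_ : InnerProductSpace ℂ H) (_ : CompleteSpace H)
      (π : A →⋆ₙₐ[ℂ] (H →L[ℂ] H)),
      Function.Injective π ∧ IsQuasidiagonalSet (Set.range π)

/-! ### The minimal tensor product -/

/-- A `*`-representation of `A` on a complex Hilbert space. The Hilbert space lives in the universe
of `A`, as the universal representation of `A` does. -/
structure HilbertRep (A : Type u) [NonUnitalCStarAlgebra A] where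
  /-- The Hilbert space. -/
  H : Type u
  [normedAddCommGroup : NormedAddCommGroup H]
  [innerProductSpace : InnerProductSpace ℂ H]
  [completeSpace : CompleteSpace H]
  /-- The `*`-homomorphism into the bounded operators. -/
  π : A →⋆ₙₐ[ℂ] (H →L[ℂ] H)

attribute [instance] HilbertRep.normedAddCommGroup HilbertRep.innerProductSpace
  HilbertRep.completeSpace

section HilbertTensor

variable (H : Type u) [NormedAddCommGroup H] [InnerProductSpace ℂ H]
  (K : Type v) [NormedAddCommGroup K] [InnerProductSpace ℂ K]

/-- The Hilbert space tensor product of `H` and `K`: the completion of the algebraic one. -/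
abbrev HilbertTensor : Type (max u v) := UniformSpace.Completion (H ⊗[ℂ] K)

variable {H K}

/-- The operator `S ⊗ T` on the Hilbert space tensor product, the continuous extension of
`ξ ⊗ η ↦ S ξ ⊗ T η`. -/
def opTensor (S : H →L[ℂ] H) (T : K →L[ℂ] K) : HilbertTensor H K →L[ℂ] HilbertTensor H K :=
  (TensorProduct.mapL S T).completion

lemma norm_opTensor_le (S : H →L[ℂ] H) (T : K →L[ℂ] K) : ‖opTensor S T‖ ≤ ‖S‖ * ‖T‖ := by
  refine ContinuousLinearMap.opNorm_le_bound _ (by positivity) fun x => ?_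
  induction x using UniformSpace.Completion.induction_on with
  | hp => exact isClosed_le (by fun_prop) (by fun_prop)
  | ih x =>
    rw [opTensor, ContinuousLinearMap.completion_apply_coe, UniformSpace.Completion.norm_coe,
      UniformSpace.Completion.norm_coe]
    exact (ContinuousLinearMap.le_opNorm _ _).trans
      (mul_le_mul_of_nonneg_right (TensorProduct.norm_mapL_le S T) (norm_nonneg _))

end HilbertTensor

section MinTensor

variable (A : Type u) [NonUnitalCStarAlgebra A] (B : Type v) [NonUnitalCStarAlgebra B]

variable {A B} in
/-- The C*-algebra `B(H_π ⊗ K_ρ)` for a pair of `*`-representations `π` of `A` and `ρ` of `B`. -/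
def RepOperators (r : HilbertRep A × HilbertRep B) : Type (max u v) :=
  HilbertTensor r.1.H r.2.H →L[ℂ] HilbertTensor r.1.H r.2.H

instance (r : HilbertRep A × HilbertRep B) : CStarAlgebra (RepOperators r) :=
  inferInstanceAs (CStarAlgebra (HilbertTensor r.1.H r.2.H →L[ℂ] HilbertTensor r.1.H r.2.H))

/-- The C*-algebra `∏ B(H_π ⊗ K_ρ)` over all pairs of `*`-representations `π` of `A` and `ρ`
of `B`, with the supremum norm. -/
abbrev RepProduct : Type (max (u + 1) (v + 1)) :=
  lp (fun r : HilbertRep A × HilbertRep B => RepOperators r) ∞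

variable {A B}

/-- The elementary tensor `a ⊗ b`, acting as `π(a) ⊗ ρ(b)` for each pair `(π, ρ)` of
`*`-representations. -/
def elemTensor (a : A) (b : B) : RepProduct A B :=
  ⟨fun r => opTensor (r.1.π a) (r.2.π b), memℓp_infty ⟨‖a‖ * ‖b‖, by
    rintro _ ⟨r, rfl⟩
    exact (norm_opTensor_le _ _).trans (mul_le_mul (NonUnitalStarAlgHom.norm_apply_le r.1.π a)
      (NonUnitalStarAlgHom.norm_apply_le r.2.π b) (norm_nonneg _) (norm_nonneg _))⟩⟩

variable (A B)

/-- The minimal (spatial) tensor product of two C*-algebras: the C*-algebra generated by the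
elementary tensors `a ⊗ b`, that is, the completion of the algebraic tensor product for the norm
`‖∑ aᵢ ⊗ bᵢ‖ = sup ‖∑ π(aᵢ) ⊗ ρ(bᵢ)‖`, the supremum being over all pairs of
`*`-representations `π` of `A` and `ρ` of `B`. -/
def MinTensor : NonUnitalStarSubalgebra ℂ (RepProduct A B) :=
  (NonUnitalStarAlgebra.adjoin ℂ {x | ∃ a b, x = elemTensor a b}).topologicalClosure

instance : NonUnitalCStarAlgebra (MinTensor A B) :=
  NonUnitalStarSubalgebra.nonUnitalCStarAlgebra (MinTensor A B)
    (h_closed := NonUnitalStarSubalgebra.isClosed_topologicalClosure _)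

end MinTensor

end

noncomputable section

/-! ### Asymptotic homomorphisms and embeddings into `∏ₖ Aₖ / ∑ₖ Aₖ` -/

section Asymptotic

variable {E : ℕ → Type u} [∀ k, NonUnitalCStarAlgebra (E k)]
  {C : Type v} [NonUnitalCStarAlgebra C]

/-! Let `π` and `pᵢ` witness quasidiagonality of `A`, with `pᵢ` of rank `mᵢ`. Compressing `π(a) ⊗ b`
by `pᵢ ⊗ 1` gives linear maps from `A ⊙ B` to `M_{mᵢ}(B)`. They are contractive for the minimal
norm, asymptotically multiplicative because `pᵢ` asymptotically commutes with `π(a)`, and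
asymptotically isometric because `pᵢ → 1` strongly. Hence the minimal tensor product embeds into `∏
M_{mᵢ}(B) / ∑ M_{mᵢ}(B)` (`exists_embedding_minTensor`). The norm argument uses that any pair of
faithful representations computes the minimal norm (`norm_algTensor`); for `B` a faithful
representation comes from GNS applied to a faithful functional, built from ultrafilter limits of
vector functionals on matrix algebras.

It remains to replace `M_{mᵢ}(B)` by matrix algebras over `ℂ`. Applying an asymptotic embedding of
`B` entrywise embeds `M_m(B)` into `∏ M_m(M_{nₖ}) / ∑ M_m(M_{nₖ})`, and `M_m(M_n)` is a matrix
algebra. The two limits are combined through the local property `IsLocallyMF`: it passes from the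
factors `Eₖ` to subalgebras of `∏ Eₖ / ∑ Eₖ` (`IsLocallyMF.of_prodModSum`), and for separable
algebras it gives back a single sequence of matrix algebras (`IsLocallyMF.isMF`). -/

lemma ProdModSum.mk_eq_zero {x : lp E ∞} :
    ProdModSum.mk E x = 0 ↔ Tendsto (fun k => ‖x k‖) atTop (𝓝 0) := by
  rw [← (ProdModSum.mk E).map_zero, ProdModSum.mk_eq_mk, sub_zero, mem_sumIdeal]

/-- The quotient norm is the upper limit of the coordinate norms. Upper estimates therefore hold
eventually, but lower ones only along a subsequence depending on `x`; this is why `IsLocallyMF` asks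
for a lower bound at one element only. -/
lemma ProdModSum.frequently_le_norm (x : lp E ∞) {ε : ℝ} (hε : 0 < ε) :
    ∃ᶠ k in atTop, ‖ProdModSum.mk E x‖ - ε ≤ ‖x k‖ := by
  intro h
  have h' : ∀ᶠ k in atTop, ‖x k‖ ≤ ‖ProdModSum.mk E x‖ - ε := h.mono fun k hk => (not_le.1 hk).le
  obtain ⟨k, hk⟩ := h'.exists
  have := ProdModSum.norm_mk_le_of_eventually ((norm_nonneg _).trans hk) h'
  linarith

/-- A sequence of linear maps that is asymptotically multiplicative, `*`-preserving and isometric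
(the latter in the sense of upper limits of norms). -/
structure IsAsymptoticEmbedding (s : ∀ k, C →ₗ[ℂ] E k) : Prop where
  eventually_norm_le : ∀ x, ∀ ε : ℝ, 0 < ε → ∀ᶠ k in atTop, ‖s k x‖ ≤ ‖x‖ + ε
  frequently_le_norm : ∀ x, ∀ ε : ℝ, 0 < ε → ∃ᶠ k in atTop, ‖x‖ - ε ≤ ‖s k x‖
  map_mul : ∀ x y, Tendsto (fun k => ‖s k (x * y) - s k x * s k y‖) atTop (𝓝 0)
  map_star : ∀ x, Tendsto (fun k => ‖s k (star x) - star (s k x)‖) atTop (𝓝 0)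

/-- The quotient map has a linear section by pure linear algebra, and its coordinates lift `φ`. No
continuity is claimed for the section, so all estimates on the lifts are pointwise in `x`. -/
lemma exists_isAsymptoticEmbedding (φ : C →⋆ₙₐ[ℂ] ProdModSum E) (hφ : Function.Injective φ) :
    ∃ s : ∀ k, C →ₗ[ℂ] E k, IsAsymptoticEmbedding s := by
  obtain ⟨g, hg⟩ := (ProdModSum.mk E).exists_rightInverse_of_surjective
    (LinearMap.range_eq_top.2 ProdModSum.mk_surjective)
  have hg' : ∀ z, ProdModSum.mk E (g z) = z := fun z => LinearMap.congr_fun hg z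
  let s : ∀ k, C →ₗ[ℂ] E k := fun k =>
    { toFun := fun x => g (φ x) k
      map_add' := fun x y => by rw [map_add, map_add, lp.coeFn_add, Pi.add_apply]
      map_smul' := fun c x => by
        rw [map_smul, map_smul, lp.coeFn_smul, Pi.smul_apply, RingHom.id_apply] }
  have hn : ∀ x, ‖ProdModSum.mk E (g (φ x))‖ = ‖x‖ := fun x => by
    rw [hg', NonUnitalStarAlgHom.norm_map φ hφ]
  refine ⟨s, fun x ε hε => ?_, fun x ε hε => ?_, fun x y => ?_, fun x => ?_⟩
  · rw [← hn x]
    exact ProdModSum.eventually_norm_le (g (φ x)) hε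
  · rw [← hn x]
    exact ProdModSum.frequently_le_norm (g (φ x)) hε
  · have : ProdModSum.mk E (g (φ (x * y)) - g (φ x) * g (φ y)) = 0 := by
      rw [map_sub, ProdModSum.mk_mul, hg', hg', hg', map_mul φ, sub_self]
    exact ProdModSum.mk_eq_zero.1 this
  · have : ProdModSum.mk E (g (φ (star x)) - star (g (φ x))) = 0 := by
      rw [map_sub, ProdModSum.mk_star, hg', hg', StarHomClass.map_star, sub_self]
    exact ProdModSum.mk_eq_zero.1 this

lemma memℓp_infty_of_eventually_norm_le {x : ∀ k, E k} {r : ℝ}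
    (h : ∀ᶠ k in atTop, ‖x k‖ ≤ r) : Memℓp x ∞ := by
  obtain ⟨N, hN⟩ := eventually_atTop.1 h
  refine memℓp_infty ⟨r ⊔ ∑ k ∈ Finset.range N, ‖x k‖, ?_⟩
  rintro _ ⟨k, rfl⟩
  rcases lt_or_ge k N with hk | hk
  · exact (Finset.single_le_sum (f := fun k => ‖x k‖) (fun _ _ => norm_nonneg _)
      (Finset.mem_range.2 hk)).trans le_sup_right
  · exact (hN k hk).trans le_sup_left

/-- No norm estimate beyond pointwise boundedness is needed, since injectivity of a `*`-homomorphism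
between C*-algebras already makes it isometric. -/
lemma exists_starAlgHom_of_asymptotic (s : ∀ k, C →ₗ[ℂ] E k)
    (hb : ∀ x, ∃ r : ℝ, ∀ᶠ k in atTop, ‖s k x‖ ≤ r)
    (hmul : ∀ x y, Tendsto (fun k => ‖s k (x * y) - s k x * s k y‖) atTop (𝓝 0))
    (hstar : ∀ x, Tendsto (fun k => ‖s k (star x) - star (s k x)‖) atTop (𝓝 0))
    (hinj : ∀ x, Tendsto (fun k => ‖s k x‖) atTop (𝓝 0) → x = 0) :
    ∃ φ : C →⋆ₙₐ[ℂ] ProdModSum E, Function.Injective φ := by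
  have hm : ∀ x, Memℓp (fun k => s k x) ∞ := fun x =>
    memℓp_infty_of_eventually_norm_le (hb x).choose_spec
  let t : C →ₗ[ℂ] lp E ∞ :=
    { toFun := fun x => ⟨fun k => s k x, hm x⟩
      map_add' := fun x y => by ext k; exact (s k).map_add x y
      map_smul' := fun c x => by ext k; exact (s k).map_smul c x }
  let φ : C →⋆ₙₐ[ℂ] ProdModSum E :=
    { toFun := fun x => ProdModSum.mk E (t x)
      map_zero' := by simp
      map_add' := fun x y => by simp
      map_smul' := fun c x => by simp
      map_mul' := fun x y => by
        rw [← ProdModSum.mk_mul, ProdModSum.mk_eq_mk, mem_sumIdeal]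
        exact hmul x y
      map_star' := fun x => by
        rw [← ProdModSum.mk_star, ProdModSum.mk_eq_mk, mem_sumIdeal]
        exact hstar x }
  exact ⟨φ, (injective_iff_map_eq_zero φ).2 fun x hx => hinj x (ProdModSum.mk_eq_zero.1 hx)⟩

end Asymptotic

/-! ### A local characterization of MF algebras -/

section LocallyMF

/-- The local form of the MF property: every finite set is mapped almost multiplicatively,
almost `*`-preservingly and almost contractively into a matrix algebra by a linear map almost
preserving the norm of a given element. -/
def IsLocallyMF (C : Type u) [NonUnitalCStarAlgebra C] : Prop :=
  ∀ (F : Finset C) (ε : ℝ) (x₀ : C), 0 < ε →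
    ∃ (n : ℕ) (θ : C →ₗ[ℂ] Matrix (Fin n) (Fin n) ℂ),
      (∀ x ∈ F, ‖θ x‖ ≤ ‖x‖ + ε) ∧
      (∀ x ∈ F, ∀ y ∈ F, ‖θ (x * y) - θ x * θ y‖ ≤ ε) ∧
      (∀ x ∈ F, ‖θ (star x) - star (θ x)‖ ≤ ε) ∧
      ‖x₀‖ - ε ≤ ‖θ x₀‖

lemma IsLocallyMF.of_starAlgHom_matrix {C : Type u} [NonUnitalCStarAlgebra C] {n : ℕ}
    (φ : C →⋆ₙₐ[ℂ] Matrix (Fin n) (Fin n) ℂ) (hφ : Function.Injective φ) : IsLocallyMF C := by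
  intro F ε x₀ hε
  have hn := NonUnitalStarAlgHom.norm_map φ hφ
  refine ⟨n, (φ : C →ₗ[ℂ] Matrix (Fin n) (Fin n) ℂ), fun x _ => ?_, fun x _ y _ => ?_,
    fun x _ => ?_, ?_⟩
  · change ‖φ x‖ ≤ _
    rw [hn]
    linarith
  · change ‖φ (x * y) - φ x * φ y‖ ≤ ε
    rw [map_mul, sub_self, norm_zero]
    exact hε.le
  · change ‖φ (star x) - star (φ x)‖ ≤ ε
    rw [map_star, sub_self, norm_zero]
    exact hε.le
  · change _ ≤ ‖φ x₀‖
    rw [hn]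
    linarith

/-- Compose a coordinate `s k` of a linear lift with a local map `θ` of `E k`. -/
lemma IsLocallyMF.of_prodModSum {E : ℕ → Type u} [∀ k, NonUnitalCStarAlgebra (E k)]
    {C : Type v} [NonUnitalCStarAlgebra C] (hE : ∀ k, IsLocallyMF (E k))
    (φ : C →⋆ₙₐ[ℂ] ProdModSum E) (hφ : Function.Injective φ) : IsLocallyMF C := by
  classical
  obtain ⟨s, hs⟩ := exists_isAsymptoticEmbedding φ hφ
  intro F ε x₀ hε
  have h3 : 0 < ε / 3 := by positivity
  have e1 : ∀ᶠ k in atTop, ∀ x ∈ F, ‖s k x‖ ≤ ‖x‖ + ε / 3 :=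
    (eventually_all_finset F).2 fun x _ => hs.eventually_norm_le x _ h3
  have e2 : ∀ᶠ k in atTop, ∀ x ∈ F, ∀ y ∈ F, ‖s k (x * y) - s k x * s k y‖ < ε / 3 :=
    (eventually_all_finset F).2 fun x _ => (eventually_all_finset F).2 fun y _ =>
      (hs.map_mul x y).eventually (gt_mem_nhds h3)
  have e3 : ∀ᶠ k in atTop, ∀ x ∈ F, ‖s k (star x) - star (s k x)‖ < ε / 3 :=
    (eventually_all_finset F).2 fun x _ => (hs.map_star x).eventually (gt_mem_nhds h3)
  -- One frequent condition can be met together with finitely many eventual ones; two frequent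
  -- conditions could not.
  obtain ⟨k, h0, h1, h2, h4⟩ :=
    ((hs.frequently_le_norm x₀ _ h3).and_eventually (e1.and (e2.and e3))).exists
  -- The defects of `s k` are included because `θ` is controlled only on the chosen finite set: it
  -- must keep these small elements small.
  let G : Finset (E k) := F.image (s k) ∪
    ((F ×ˢ F).image (fun p => s k (p.1 * p.2) - s k p.1 * s k p.2) ∪
      F.image (fun x => s k (star x) - star (s k x)))
  obtain ⟨n, θ, t1, t2, t3, t4⟩ := hE k G (ε / 3) (s k x₀) h3
  have m1 : ∀ x ∈ F, s k x ∈ G := fun x hx =>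
    Finset.mem_union_left _ (Finset.mem_image_of_mem _ hx)
  have m2 : ∀ x ∈ F, ∀ y ∈ F, s k (x * y) - s k x * s k y ∈ G := fun x hx y hy =>
    Finset.mem_union_right _ (Finset.mem_union_left _
      (Finset.mem_image.2 ⟨(x, y), Finset.mk_mem_product hx hy, rfl⟩))
  have m3 : ∀ x ∈ F, s k (star x) - star (s k x) ∈ G := fun x hx =>
    Finset.mem_union_right _ (Finset.mem_union_right _ (Finset.mem_image.2 ⟨x, hx, rfl⟩))
  refine ⟨n, θ ∘ₗ s k, fun x hx => ?_, fun x hx y hy => ?_, fun x hx => ?_, ?_⟩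
  · have a1 := t1 _ (m1 x hx)
    have a2 := h1 x hx
    simp only [LinearMap.comp_apply]
    linarith
  · have a1 := t1 _ (m2 x hx y hy)
    have a2 := t2 _ (m1 x hx) _ (m1 y hy)
    have a3 := h2 x hx y hy
    have e : θ (s k (x * y)) - θ (s k x) * θ (s k y) =
        θ (s k (x * y) - s k x * s k y) + (θ (s k x * s k y) - θ (s k x) * θ (s k y)) := by
      rw [map_sub]; abel
    simp only [LinearMap.comp_apply]
    rw [e]
    refine (norm_add_le _ _).trans ?_
    linarith
  · have a1 := t1 _ (m3 x hx)
    have a2 := t3 _ (m1 x hx)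
    have a3 := h4 x hx
    have e : θ (s k (star x)) - star (θ (s k x)) =
        θ (s k (star x) - star (s k x)) + (θ (star (s k x)) - star (θ (s k x))) := by
      rw [map_sub]; abel
    simp only [LinearMap.comp_apply]
    rw [e]
    refine (norm_add_le _ _).trans ?_
    linarith
  · simp only [LinearMap.comp_apply]
    linarith

/-- The target of the maps in `IsLocallyMF` may be taken to be nonzero. -/
lemma IsLocallyMF.exists_pos {C : Type u} [NonUnitalCStarAlgebra C] (h : IsLocallyMF C)
    (F : Finset C) {ε : ℝ} (x₀ : C) (hε : 0 < ε) :
    ∃ (n : ℕ) (_ : 0 < n) (θ : C →ₗ[ℂ] Matrix (Fin n) (Fin n) ℂ),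
      (∀ x ∈ F, ‖θ x‖ ≤ ‖x‖ + ε) ∧
      (∀ x ∈ F, ∀ y ∈ F, ‖θ (x * y) - θ x * θ y‖ ≤ ε) ∧
      (∀ x ∈ F, ‖θ (star x) - star (θ x)‖ ≤ ε) ∧
      ‖x₀‖ - ε ≤ ‖θ x₀‖ := by
  obtain ⟨n, θ, h1, h2, h3, h4⟩ := h F ε x₀ hε
  -- If `n = 0` then `θ x₀ = 0`, so `‖x₀‖ ≤ ε` and the zero map into `1 × 1` matrices serves.
  rcases Nat.eq_zero_or_pos n with rfl | hn
  · refine ⟨1, one_pos, 0, fun x _ => ?_, fun x _ y _ => ?_, fun x _ => ?_, ?_⟩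
    · simpa using add_nonneg (norm_nonneg x) hε.le
    · simpa using hε.le
    · simpa using hε.le
    · rw [Subsingleton.elim (θ x₀) 0, norm_zero] at h4
      simpa using h4
  · exact ⟨n, hn, θ, h1, h2, h3, h4⟩

end LocallyMF

/-! ### From local maps to a global embedding, for separable algebras. -/

section Extension

variable {C : Type u} [NonUnitalCStarAlgebra C]

/-- An isometric map respecting the operations on a dense set closed under them extends to an
embedding. -/
lemma exists_starAlgHom_of_dense {P : Type v} [NonUnitalCStarAlgebra P] {S : Set C}
    {Z : Set ℂ} (hZ : Dense Z) (hS : Dense S)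
    (hsub : ∀ x ∈ S, ∀ y ∈ S, x - y ∈ S) (g : C → P)
    (gsub : ∀ x ∈ S, ∀ y ∈ S, g (x - y) = g x - g y)
    (gmul : ∀ x ∈ S, ∀ y ∈ S, x * y ∈ S ∧ g (x * y) = g x * g y)
    (gstar : ∀ x ∈ S, star x ∈ S ∧ g (star x) = star (g x))
    (gsmul : ∀ z ∈ Z, ∀ x ∈ S, z • x ∈ S ∧ g (z • x) = z • g x)
    (gnorm : ∀ x ∈ S, ‖g x‖ = ‖x‖) :
    ∃ φ : C →⋆ₙₐ[ℂ] P, Function.Injective φ := by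
  have hd : DenseRange ((↑) : S → C) := hS.denseRange_val
  have hi : IsUniformInducing ((↑) : S → C) := isUniformEmbedding_subtype_val.isUniformInducing
  have huc : UniformContinuous fun x : S => g x := by
    refine Isometry.uniformContinuous (Isometry.of_dist_eq fun x y => ?_)
    rw [dist_eq_norm, ← gsub _ x.2 _ y.2, gnorm _ (hsub _ x.2 _ y.2), Subtype.dist_eq,
      dist_eq_norm]
  let f : C → P := (hi.isDenseInducing hd).extend fun x : S => g x
  have hf : Continuous f := (uniformContinuous_uniformly_extend hi hd huc).continuous
  have hfg : ∀ x ∈ S, f x = g x := fun x hx => uniformly_extend_of_ind hi hd huc ⟨x, hx⟩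
  have fsub : ∀ x y, f (x - y) = f x - f y := fun x y =>
    hd.induction_on₂ (p := fun x y => f (x - y) = f x - f y)
      (isClosed_eq (by fun_prop) (by fun_prop)) (fun x y => by
        rw [hfg _ x.2, hfg _ y.2, hfg _ (hsub _ x.2 _ y.2), gsub _ x.2 _ y.2]) x y
  have fmul : ∀ x y, f (x * y) = f x * f y := fun x y =>
    hd.induction_on₂ (p := fun x y => f (x * y) = f x * f y)
      (isClosed_eq (by fun_prop) (by fun_prop)) (fun x y => by
        rw [hfg _ x.2, hfg _ y.2, hfg _ (gmul _ x.2 _ y.2).1, (gmul _ x.2 _ y.2).2]) x y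
  have fstar : ∀ x, f (star x) = star (f x) := fun x =>
    hd.induction_on (p := fun x => f (star x) = star (f x)) x
      (isClosed_eq (by fun_prop) (by fun_prop)) fun x => by
        rw [hfg _ x.2, hfg _ (gstar _ x.2).1, (gstar _ x.2).2]
  have fnorm : ∀ x, ‖f x‖ = ‖x‖ := fun x =>
    hd.induction_on (p := fun x => ‖f x‖ = ‖x‖) x
      (isClosed_eq (by fun_prop) (by fun_prop)) fun x => by rw [hfg _ x.2, gnorm _ x.2]
  have fsmul : ∀ (z : ℂ) x, f (z • x) = z • f x := fun z x => by
    -- Two density arguments: first in the vector for scalars in `Z`, then in the scalar.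
    have h1 : ∀ z ∈ Z, ∀ x, f (z • x) = z • f x := fun z hz x =>
      hd.induction_on (p := fun x => f (z • x) = z • f x) x
        (isClosed_eq (by fun_prop) (by fun_prop)) fun x => by
          rw [hfg _ x.2, hfg _ (gsmul z hz _ x.2).1, (gsmul z hz _ x.2).2]
    exact hZ.denseRange_val.induction_on (p := fun z : ℂ => f (z • x) = z • f x) z
      (isClosed_eq (by fun_prop) (by fun_prop)) fun z => h1 _ z.2 x
  have fadd : ∀ x y, f (x + y) = f x + f y := (AddMonoidHom.ofMapSub f fsub).map_add
  let φ : C →⋆ₙₐ[ℂ] P :=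
    { toFun := f
      map_zero' := (AddMonoidHom.ofMapSub f fsub).map_zero
      map_add' := fadd
      map_smul' := fsmul
      map_mul' := fmul
      map_star' := fstar }
  refine ⟨φ, (injective_iff_map_eq_zero φ).2 fun x hx => ?_⟩
  rw [← norm_eq_zero, ← fnorm x]
  exact norm_eq_zero.2 hx

/-- A separable C*-algebra has a countable dense subset closed under subtraction, multiplication,
the involution and the action of a given countable set of scalars. -/
lemma exists_countable_dense_closed [TopologicalSpace.SeparableSpace C] {Z : Set ℂ}
    (hZ : Z.Countable) :
    ∃ S : Set C, S.Countable ∧ Dense S ∧ (∀ x ∈ S, ∀ y ∈ S, x - y ∈ S) ∧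
      (∀ x ∈ S, ∀ y ∈ S, x * y ∈ S) ∧ (∀ x ∈ S, star x ∈ S) ∧ ∀ z ∈ Z, ∀ x ∈ S, z • x ∈ S := by
  obtain ⟨D, hDc, hDd⟩ := TopologicalSpace.exists_countable_dense C
  let step : Set C → Set C := fun T => T ∪ (Set.image2 (· - ·) T T ∪
    (Set.image2 (· * ·) T T ∪ (star '' T ∪ Set.image2 (· • ·) Z T)))
  let T : ℕ → Set C := fun n => step^[n] D
  have hT : ∀ n, T (n + 1) = step (T n) := fun n => Function.iterate_succ_apply' step n D
  have hmono : Monotone T := monotone_nat_of_le_succ fun n => by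
    rw [hT]
    exact Set.subset_union_left
  have hc : ∀ n, (T n).Countable := fun n => by
    induction n with
    | zero => exact hDc
    | succ n ih =>
      rw [hT]
      exact ih.union ((ih.image2 ih _).union ((ih.image2 ih _).union
        ((ih.image _).union (hZ.image2 ih _))))
  have key : ∀ {x y}, x ∈ ⋃ n, T n → y ∈ ⋃ n, T n → ∃ n, x ∈ T n ∧ y ∈ T n := fun hx hy => by
    obtain ⟨a, ha⟩ := Set.mem_iUnion.1 hx
    obtain ⟨b, hb⟩ := Set.mem_iUnion.1 hy
    exact ⟨max a b, hmono (le_max_left a b) ha, hmono (le_max_right a b) hb⟩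
  refine ⟨⋃ n, T n, Set.countable_iUnion hc, hDd.mono (Set.subset_iUnion T 0),
    fun x hx y hy => ?_, fun x hx y hy => ?_, fun x hx => ?_, fun z hz x hx => ?_⟩
  · obtain ⟨n, h1, h2⟩ := key hx hy
    refine Set.mem_iUnion.2 ⟨n + 1, ?_⟩
    rw [hT]
    exact .inr (.inl ⟨x, h1, y, h2, rfl⟩)
  · obtain ⟨n, h1, h2⟩ := key hx hy
    refine Set.mem_iUnion.2 ⟨n + 1, ?_⟩
    rw [hT]
    exact .inr (.inr (.inl ⟨x, h1, y, h2, rfl⟩))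
  · obtain ⟨n, h1⟩ := Set.mem_iUnion.1 hx
    refine Set.mem_iUnion.2 ⟨n + 1, ?_⟩
    rw [hT]
    exact .inr (.inr (.inr (.inl ⟨x, h1, rfl⟩)))
  · obtain ⟨n, h1⟩ := Set.mem_iUnion.1 hx
    refine Set.mem_iUnion.2 ⟨n + 1, ?_⟩
    rw [hT]
    exact .inr (.inr (.inr (.inr ⟨z, hz, x, h1, rfl⟩)))

/-- A diagonal sequence of local maps is controlled only on a countable set, so it defines a map to
the quotient only there. A countable dense set closed under the operations, with scalars from a
countable dense set, makes that map isometric and compatible with the operations, and it extends by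
continuity. -/
theorem IsLocallyMF.isMF [TopologicalSpace.SeparableSpace C] (h : IsLocallyMF C) : IsMF C := by
  classical
  refine ⟨inferInstance, ?_⟩
  obtain ⟨Z, hZc, hZd⟩ := TopologicalSpace.exists_countable_dense ℂ
  obtain ⟨S, hSc, hSd, ssub, smul, sstar, ssmul⟩ := exists_countable_dense_closed (C := C) hZc
  obtain ⟨d, hd⟩ := hSc.exists_eq_range hSd.nonempty
  have hdS : ∀ a, d a ∈ S := fun a => hd ▸ Set.mem_range_self a
  have hSd' : ∀ x ∈ S, ∃ a, d a = x := fun x hx => by rwa [hd] at hx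
  -- The `j`-th map is almost multiplicative on `d 0, …, d j` and almost preserves the norm of `d
  -- a`, where `j` codes a pair `(a, N)`. Each `d a` is thus tested for infinitely many `j`.
  choose n hn θ t1 t2 t3 t4 using fun j : ℕ =>
    h.exists_pos ((Finset.range (j + 1)).image d) (ε := 1 / (j + 1)) (d (Nat.unpair j).1)
      Nat.one_div_pos_of_nat
  have hmem : ∀ x ∈ S, ∀ᶠ j in atTop, x ∈ (Finset.range (j + 1)).image d := fun x hx => by
    obtain ⟨a, rfl⟩ := hSd' x hx
    filter_upwards [eventually_ge_atTop a] with j hj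
    exact Finset.mem_image_of_mem _ (Finset.mem_range.2 (by omega))
  have hlim : Tendsto (fun j : ℕ => 1 / ((j : ℝ) + 1)) atTop (𝓝 0) :=
    tendsto_one_div_add_atTop_nhds_zero_nat
  have hm : ∀ x ∈ S, Memℓp (fun j => θ j x) ∞ := fun x hx => by
    refine memℓp_infty_of_eventually_norm_le (r := ‖x‖ + 1) ?_
    filter_upwards [hmem x hx] with j hj
    refine (t1 j x hj).trans (by gcongr; exact div_le_one_of_le₀ (by simp) (by positivity))
  let P := ProdModSum fun k => Matrix (Fin (n k)) (Fin (n k)) ℂ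
  -- The value off `S` is irrelevant: only the restriction to `S` is extended.
  let g : C → P := fun x => if hx : x ∈ S then ProdModSum.mk _ ⟨_, hm x hx⟩ else 0
  have hg : ∀ x (hx : x ∈ S), g x = ProdModSum.mk _ ⟨_, hm x hx⟩ := fun x hx => dif_pos hx
  refine ⟨n, hn, exists_starAlgHom_of_dense hZd hSd ssub g (fun x hx y hy => ?_)
    (fun x hx y hy => ⟨smul x hx y hy, ?_⟩) (fun x hx => ⟨sstar x hx, ?_⟩)
    (fun z hz x hx => ⟨ssmul z hz x hx, ?_⟩) (fun x hx => ?_)⟩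
  · rw [hg _ (ssub x hx y hy), hg x hx, hg y hy, ← map_sub]
    congr 1
    ext1
    funext j
    exact (θ j).map_sub x y
  · rw [hg _ (smul x hx y hy), hg x hx, hg y hy, ← ProdModSum.mk_mul, ProdModSum.mk_eq_mk,
      mem_sumIdeal]
    refine squeeze_zero' (.of_forall fun _ => norm_nonneg _) ?_ hlim
    filter_upwards [hmem x hx, hmem y hy] with j h1 h2
    exact t2 j x h1 y h2
  · rw [hg _ (sstar x hx), hg x hx, ← ProdModSum.mk_star, ProdModSum.mk_eq_mk, mem_sumIdeal]
    refine squeeze_zero' (.of_forall fun _ => norm_nonneg _) ?_ hlim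
    filter_upwards [hmem x hx] with j h1
    exact t3 j x h1
  · rw [hg _ (ssmul z hz x hx), hg x hx, ← map_smul]
    congr 1
    ext1
    funext j
    exact (θ j).map_smul z x
  · rw [hg x hx]
    refine le_antisymm (le_of_forall_pos_le_add fun ε hε => ?_)
      (le_of_forall_pos_le_add fun ε hε => ?_)
    · refine ProdModSum.norm_mk_le_of_eventually (by positivity) ?_
      filter_upwards [hmem x hx, hlim.eventually (gt_mem_nhds hε)] with j h1 h2
      exact (t1 j x h1).trans (by gcongr)
    · obtain ⟨a, rfl⟩ := hSd' x hx
      have e1 := ProdModSum.eventually_norm_le ⟨_, hm (d a) hx⟩ (half_pos hε)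
      have e2 := hlim.eventually (gt_mem_nhds (half_pos hε))
      obtain ⟨N, hN⟩ := eventually_atTop.1 (e1.and e2)
      -- The index `Nat.pair a N` is at least `N` and is one at which `d a` is tested.
      obtain ⟨h1, h2⟩ := hN (Nat.pair a N) (Nat.right_le_pair a N)
      have h3 := t4 (Nat.pair a N)
      rw [Nat.unpair_pair] at h3
      have h1' : ‖θ (Nat.pair a N) (d a)‖ ≤ _ := h1
      linarith

end Extension

/-! ### Matrix algebras over C*-algebras -/

section CStarMatrix

namespace CStarMatrix

variable {m : Type*} [Fintype m] [DecidableEq m]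
  {E : Type*} [NonUnitalCStarAlgebra E] [PartialOrder E] [StarOrderedRing E]

/-- By the C*-identity it suffices to bound `x*x` placed at the diagonal position `(t, t)`, and
diagonal placement is a `*`-homomorphism, hence contractive. -/
lemma norm_ofMatrix_single_le (s t : m) (x : E) : ‖ofMatrix (Matrix.single s t x)‖ ≤ ‖x‖ := by
  let φ : E →⋆ₙₐ[ℂ] CStarMatrix m m E :=
    { toFun := fun y => ofMatrix (Matrix.single t t y)
      map_zero' := congrArg ofMatrix (Matrix.single_zero t t)
      map_add' := fun y z => congrArg ofMatrix (Matrix.single_add t t y z)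
      map_smul' := fun c y => congrArg ofMatrix (Matrix.smul_single c t t y).symm
      map_mul' := fun y z => congrArg ofMatrix (Matrix.single_mul_single_same y t t t z).symm
      map_star' := fun y => congrArg ofMatrix (Matrix.conjTranspose_single t t y).symm }
  have h1 : star (ofMatrix (Matrix.single s t x)) * ofMatrix (Matrix.single s t x) =
      φ (star x * x) := by
    refine Eq.trans ?_ (congrArg ofMatrix (Matrix.single_mul_single_same (star x) t s t x))
    exact congrArg (fun y : CStarMatrix m m E => y * ofMatrix (Matrix.single s t x))
      (congrArg ofMatrix (Matrix.conjTranspose_single s t x))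
  refine abs_le_of_sq_le_sq' ?_ (norm_nonneg _) |>.2
  rw [sq, sq, ← CStarRing.norm_star_mul_self, h1, ← CStarRing.norm_star_mul_self]
  exact NonUnitalStarAlgHom.norm_apply_le φ _

/-- Crude, but for a fixed matrix size it reduces norm convergence to convergence of entries. -/
lemma norm_le_sum (M : CStarMatrix m m E) : ‖M‖ ≤ ∑ s, ∑ t, ‖M s t‖ := by
  have h : M = ∑ s, ∑ t, ofMatrix (Matrix.single s t (M s t)) :=
    Matrix.matrix_eq_sum_single (show Matrix m m E from M)
  conv_lhs => rw [h]
  refine (norm_sum_le _ _).trans (Finset.sum_le_sum fun s _ => (norm_sum_le _ _).trans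
    (Finset.sum_le_sum fun t _ => norm_ofMatrix_single_le s t _))

lemma tendsto_norm_zero {ι : Type*} {l : Filter ι} {F : ι → Type*}
    [∀ i, NonUnitalCStarAlgebra (F i)] [∀ i, PartialOrder (F i)] [∀ i, StarOrderedRing (F i)]
    {M : ∀ i, CStarMatrix m m (F i)}
    (h : ∀ s t, Tendsto (fun i => ‖M i s t‖) l (𝓝 0)) : Tendsto (fun i => ‖M i‖) l (𝓝 0) := by
  refine squeeze_zero (fun i => norm_nonneg _) (fun i => norm_le_sum (M i)) ?_
  simpa using tendsto_finsetSum Finset.univ fun s _ =>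
    tendsto_finsetSum Finset.univ fun t _ => h s t

lemma norm_mapₙₐ {m : Type*} [Fintype m] {F : Type*} [NonUnitalCStarAlgebra F] [PartialOrder F]
    [StarOrderedRing F]
    (φ : E →⋆ₙₐ[ℂ] F) (hφ : Function.Injective φ) (M : CStarMatrix m m E) :
    ‖mapₙₐ φ M‖ = ‖M‖ :=
  NonUnitalStarAlgHom.norm_map (mapₙₐ φ) (fun M N h => by
    ext s t
    exact hφ (congrFun (congrFun h s) t)) M

end CStarMatrix

open scoped MatrixOrder

/-- A block matrix, seen as a matrix. -/
def blockMatrixHom (m n : ℕ) :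
    CStarMatrix (Fin m) (Fin m) (Matrix (Fin n) (Fin n) ℂ) →⋆ₙₐ[ℂ]
      Matrix (Fin (m * n)) (Fin (m * n)) ℂ where
  toFun M := fun i j => M (finProdFinEquiv.symm i).1 (finProdFinEquiv.symm j).1
    (finProdFinEquiv.symm i).2 (finProdFinEquiv.symm j).2
  map_zero' := rfl
  map_add' _ _ := rfl
  map_smul' _ _ := rfl
  map_mul' M N := by
    ext i j
    refine Eq.trans ?_ (finProdFinEquiv.sum_comp (fun p =>
      M (finProdFinEquiv.symm i).1 (finProdFinEquiv.symm p).1 (finProdFinEquiv.symm i).2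
        (finProdFinEquiv.symm p).2 *
      N (finProdFinEquiv.symm p).1 (finProdFinEquiv.symm j).1 (finProdFinEquiv.symm p).2
        (finProdFinEquiv.symm j).2))
    rw [CStarMatrix.mul_apply, Matrix.sum_apply, Fintype.sum_prod_type]
    simp only [Equiv.symm_apply_apply]
    rfl
  map_star' _ := rfl

lemma blockMatrixHom_injective (m n : ℕ) : Function.Injective (blockMatrixHom m n) := by
  intro M N h
  ext s t a b
  have h1 : ∀ M : CStarMatrix (Fin m) (Fin m) (Matrix (Fin n) (Fin n) ℂ),
      blockMatrixHom m n M (finProdFinEquiv (s, a)) (finProdFinEquiv (t, b)) = M s t a b :=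
    fun M => by
      change M (finProdFinEquiv.symm (finProdFinEquiv (s, a))).1 _ _ _ = _
      rw [Equiv.symm_apply_apply, Equiv.symm_apply_apply]
  rw [← h1 M, h, h1]

/-- Matrix algebras over MF algebras are locally MF. -/
lemma IsMF.isLocallyMF_cstarMatrix {B : Type u} [NonUnitalCStarAlgebra B] [PartialOrder B]
    [StarOrderedRing B] (h : IsMF B) (m : ℕ) : IsLocallyMF (CStarMatrix (Fin m) (Fin m) B) := by
  obtain ⟨-, n, -, φ, hφ⟩ := h
  obtain ⟨s, hs⟩ := exists_isAsymptoticEmbedding φ hφ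
  let S : ∀ k, CStarMatrix (Fin m) (Fin m) B →ₗ[ℂ]
      CStarMatrix (Fin m) (Fin m) (Matrix (Fin (n k)) (Fin (n k)) ℂ) := fun k =>
    CStarMatrix.mapₗ (s k)
  have hS : ∀ k M i j, S k M i j = s k (M i j) := fun _ _ _ _ => rfl
  suffices H : ∃ ψ : CStarMatrix (Fin m) (Fin m) B →⋆ₙₐ[ℂ] ProdModSum fun k =>
      CStarMatrix (Fin m) (Fin m) (Matrix (Fin (n k)) (Fin (n k)) ℂ), Function.Injective ψ by
    obtain ⟨ψ, hψ⟩ := H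
    exact IsLocallyMF.of_prodModSum (fun k => IsLocallyMF.of_starAlgHom_matrix
      (blockMatrixHom m (n k)) (blockMatrixHom_injective m (n k))) ψ hψ
  -- As `m` does not vary with `k`, every condition can be checked entrywise.
  refine exists_starAlgHom_of_asymptotic S (fun M => ?_) (fun M N => ?_) (fun M => ?_)
    (fun M hM => ?_)
  · refine ⟨∑ i, ∑ j, (‖M i j‖ + 1), ?_⟩
    have : ∀ᶠ k in atTop, ∀ i j, ‖s k (M i j)‖ ≤ ‖M i j‖ + 1 :=
      eventually_all.2 fun i => eventually_all.2 fun j => hs.eventually_norm_le _ _ one_pos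
    filter_upwards [this] with k hk
    exact (CStarMatrix.norm_le_sum _).trans
      (Finset.sum_le_sum fun i _ => Finset.sum_le_sum fun j _ => hk i j)
  · refine CStarMatrix.tendsto_norm_zero fun i j => ?_
    have : Tendsto (fun k => ∑ l, ‖s k (M i l * N l j) - s k (M i l) * s k (N l j)‖) atTop
        (𝓝 0) := by
      simpa using tendsto_finsetSum Finset.univ fun l _ => hs.map_mul (M i l) (N l j)
    refine squeeze_zero (fun _ => norm_nonneg _) (fun k => ?_) this
    rw [CStarMatrix.sub_apply, hS, CStarMatrix.mul_apply, CStarMatrix.mul_apply, map_sum,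
      ← Finset.sum_sub_distrib]
    exact norm_sum_le _ _
  · refine CStarMatrix.tendsto_norm_zero fun i j => ?_
    exact hs.map_star (M j i)
  · ext i j
    have h1 : Tendsto (fun k => ‖s k (M i j)‖) atTop (𝓝 0) :=
      squeeze_zero (fun _ => norm_nonneg _)
        (fun k => CStarMatrix.norm_entry_le_norm (M := S k M) (i := i) (j := j)) hM
    rw [CStarMatrix.zero_apply, ← norm_le_zero_iff]
    refine le_of_forall_pos_le_add fun ε hε => ?_
    obtain ⟨k, h2, h3⟩ := ((hs.frequently_le_norm (M i j) _ (half_pos hε)).and_eventually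
      (h1.eventually (gt_mem_nhds (half_pos hε)))).exists
    linarith

end CStarMatrix

/-! ### Faithful representations of MF algebras -/

section FaithfulRep

open scoped ComplexOrder InnerProductSpace

/-- Take `x ↦ ⟪ξ, x ξ⟫` for a vector `ξ` in the unit ball at which `M` attains at least half its
norm; its value at `M* M` is `‖M ξ‖²`. -/
lemma exists_vectorFunctional {n : ℕ} (M : Matrix (Fin n) (Fin n) ℂ) :
    ∃ g : Matrix (Fin n) (Fin n) ℂ →ₗ[ℂ] ℂ, (∀ x, ‖g x‖ ≤ ‖x‖) ∧ (∀ x, 0 ≤ g (star x * x)) ∧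
      (‖M‖ / 2) ^ 2 ≤ ‖g (star M * M)‖ := by
  let T := Matrix.toEuclideanCLM (n := Fin n) (𝕜 := ℂ)
  have hT : ∀ x, ‖T x‖ = ‖x‖ := fun x => Matrix.l2_opNorm_toEuclideanCLM x
  obtain ⟨ξ, hξ, hM⟩ : ∃ ξ : EuclideanSpace ℂ (Fin n), ‖ξ‖ ≤ 1 ∧ ‖M‖ / 2 ≤ ‖T M ξ‖ := by
    rcases eq_or_ne M 0 with rfl | hM
    · exact ⟨0, by simp, by simp⟩
    · obtain ⟨ξ, h1, h2⟩ := (T M).exists_lt_apply_of_lt_opNorm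
        (r := ‖M‖ / 2) (by rw [hT]; exact half_lt_self (norm_pos_iff.2 hM))
      exact ⟨ξ, h1.le, h2.le⟩
  have hg : ∀ x, ⟪ξ, T (star x * x) ξ⟫_ℂ = ((‖T x ξ‖ ^ 2 : ℝ) : ℂ) := fun x => by
    rw [map_mul, map_star, ContinuousLinearMap.star_eq_adjoint, mul_apply_eq_comp,
      ContinuousLinearMap.adjoint_inner_right, inner_self_eq_norm_sq_to_K]
    norm_cast
  refine ⟨{ toFun := fun x => ⟪ξ, T x ξ⟫_ℂ
            map_add' := fun x y => by
              rw [map_add, add_apply, inner_add_right]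
            map_smul' := fun c x => by
              rw [map_smul, smul_apply, inner_smul_right]; rfl },
    fun x => ?_, fun x => ?_, ?_⟩
  · change ‖⟪ξ, T x ξ⟫_ℂ‖ ≤ _
    calc ‖⟪ξ, T x ξ⟫_ℂ‖ ≤ ‖ξ‖ * ‖T x ξ‖ := norm_inner_le_norm _ _
      _ ≤ 1 * (‖T x‖ * 1) := by
        gcongr
        exact (T x).le_opNorm_of_le hξ
      _ = ‖x‖ := by rw [hT]; ring
  · change 0 ≤ ⟪ξ, T (star x * x) ξ⟫_ℂ
    rw [hg]
    exact Complex.zero_le_real.2 (sq_nonneg _)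
  · change _ ≤ ‖⟪ξ, T (star M * M) ξ⟫_ℂ‖
    rw [hg, Complex.norm_real, Real.norm_of_nonneg (sq_nonneg _)]
    gcongr

variable {B : Type v} [NonUnitalCStarAlgebra B]

/-- The functional is an ultrafilter limit of vector functionals composed with `s k`. Positivity
survives because `s k (x* x)` is asymptotically `(s k x)* (s k x)`. The constant `4` collects a
factor `2` from `exists_vectorFunctional` and a factor `2` from `‖s k b‖ ≥ ‖b‖ / 2`. -/
lemma IsAsymptoticEmbedding.exists_functional {n : ℕ → ℕ}
    {s : ∀ k, B →ₗ[ℂ] Matrix (Fin (n k)) (Fin (n k)) ℂ} (hs : IsAsymptoticEmbedding s) (b : B) :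
    ∃ f : B →ₗ[ℂ] ℂ, (∀ x, ‖f x‖ ≤ ‖x‖) ∧ (∀ x, 0 ≤ f (star x * x)) ∧
      (‖b‖ / 4) ^ 2 ≤ ‖f (star b * b)‖ := by
  rcases eq_or_ne b 0 with rfl | hb
  · exact ⟨0, by simp, by simp, by simp⟩
  have hfreq := hs.frequently_le_norm b _ (half_pos (norm_pos_iff.2 hb))
  have : NeBot (atTop ⊓ 𝓟 {k | ‖b‖ - ‖b‖ / 2 ≤ ‖s k b‖}) := frequently_mem_iff_neBot.1 hfreq
  -- The lower bound on `‖s k b‖` holds only frequently; the ultrafilter is chosen to concentrate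
  -- where it holds.
  let U : Ultrafilter ℕ := Ultrafilter.of (atTop ⊓ 𝓟 {k | ‖b‖ - ‖b‖ / 2 ≤ ‖s k b‖})
  have hU : (U : Filter ℕ) ≤ atTop ⊓ 𝓟 {k | ‖b‖ - ‖b‖ / 2 ≤ ‖s k b‖} := Ultrafilter.of_le _
  have hUt : (U : Filter ℕ) ≤ atTop := hU.trans inf_le_left
  have hUb : ∀ᶠ k in (U : Filter ℕ), ‖b‖ - ‖b‖ / 2 ≤ ‖s k b‖ :=
    le_principal_iff.1 (hU.trans inf_le_right)
  choose g g1 g2 g3 using fun k => exists_vectorFunctional (s k b)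
  have hex : ∀ x, ∃ z, Tendsto (fun k => g k (s k x)) U (𝓝 z) := fun x => by
    have : (U.map fun k => g k (s k x) : Filter ℂ) ≤ 𝓟 (Metric.closedBall 0 (‖x‖ + 1)) := by
      refine le_principal_iff.2 (?_ : ∀ᶠ k in (U : Filter ℕ), _)
      filter_upwards [hUt (hs.eventually_norm_le x 1 one_pos)] with k hk
      simpa using (g1 k _).trans hk
    obtain ⟨z, -, hz⟩ := (isCompact_closedBall (0 : ℂ) (‖x‖ + 1)).ultrafilter_le_nhds _ this
    exact ⟨z, hz⟩
  choose f hf using hex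
  have hmul : ∀ x, Tendsto (fun k => g k (star (s k x) * s k x)) U (𝓝 (f (star x * x))) :=
    fun x => by
      have h1 : Tendsto (fun k => ‖s k (star x * x) - s k (star x) * s k x‖ +
          ‖s k (star x) - star (s k x)‖ * (‖x‖ + 1)) U (𝓝 0) := by
        simpa using ((hs.map_mul (star x) x).add
          ((hs.map_star x).mul_const (‖x‖ + 1))).mono_left hUt
      have h2 : Tendsto (fun k => g k (s k (star x * x) - star (s k x) * s k x)) U (𝓝 0) := by
        refine squeeze_zero_norm' ?_ h1
        filter_upwards [hUt (hs.eventually_norm_le x 1 one_pos)] with k hk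
        refine (g1 k _).trans ?_
        have : s k (star x * x) - star (s k x) * s k x =
            (s k (star x * x) - s k (star x) * s k x) + (s k (star x) - star (s k x)) * s k x := by
          noncomm_ring
        rw [this]
        refine (norm_add_le _ _).trans ?_
        gcongr
        exact (norm_mul_le _ _).trans (by gcongr)
      simpa using (hf (star x * x)).sub h2
  refine ⟨{ toFun := f
            map_add' := fun x y => tendsto_nhds_unique (hf (x + y)) (by
              simpa using (hf x).add (hf y))
            map_smul' := fun c x => tendsto_nhds_unique (hf (c • x)) (by
              simpa using (hf x).const_mul c) }, fun x => ?_, fun x => ?_, ?_⟩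
  · refine le_of_forall_pos_le_add fun ε hε => le_of_tendsto (hf x).norm ?_
    filter_upwards [hUt (hs.eventually_norm_le x ε hε)] with k hk
    exact (g1 k _).trans hk
  · exact ge_of_tendsto' (hmul x) fun k => g2 k _
  · refine ge_of_tendsto (hmul b).norm ?_
    filter_upwards [hUb] with k hk
    refine le_trans ?_ (g3 k)
    gcongr ?_ ^ 2
    linarith

/-- An MF algebra has a faithful positive functional. -/
lemma IsMF.exists_faithful_functional (h : IsMF B) :
    ∃ f : B →ₗ[ℂ] ℂ, (∀ x, 0 ≤ f (star x * x)) ∧ ∀ x, f (star x * x) = 0 → x = 0 := by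
  obtain ⟨_, n, -, φ, hφ⟩ := h
  obtain ⟨s, hs⟩ := exists_isAsymptoticEmbedding φ hφ
  obtain ⟨d, hd⟩ := TopologicalSpace.exists_dense_seq B
  choose f f1 f2 f3 using fun a => hs.exists_functional (d a)
  have hsum : ∀ x, Summable fun a => ((1 / 2 : ℂ) ^ a) * f a x := fun x => by
    refine Summable.of_norm_bounded (summable_geometric_two.mul_right ‖x‖) fun a => ?_
    rw [norm_mul, norm_pow]
    gcongr
    · simp
    · exact f1 a x
  have hpos : ∀ x a, 0 ≤ ((1 / 2 : ℂ) ^ a) * f a (star x * x) := fun x a =>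
    mul_nonneg (pow_nonneg (by norm_num [Complex.le_def]) a) (f2 a x)
  refine ⟨{ toFun := fun x => ∑' a, ((1 / 2 : ℂ) ^ a) * f a x
            map_add' := fun x y => by
              rw [← (hsum x).tsum_add (hsum y)]
              exact tsum_congr fun a => by rw [map_add, mul_add]
            map_smul' := fun c x => by
              rw [RingHom.id_apply, smul_eq_mul, ← tsum_mul_left]
              exact tsum_congr fun a => by rw [map_smul, smul_eq_mul]; ring },
    fun x => tsum_nonneg (hpos x), fun x hx => ?_⟩
  have h1 : ∑' a, ((1 / 2 : ℂ) ^ a) * f a (star x * x) = 0 := hx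
  have h0 : ∀ a, f a (star x * x) = 0 := fun a => by
    have := (hasSum_zero_iff_of_nonneg (hpos x)).1 (h1 ▸ (hsum (star x * x)).hasSum)
    simpa using congrFun this a
  -- For `y = d a`, the functional `f a` vanishes at `x* x` and is large at `y* y`. The inequality
  -- no longer mentions `a`, so density extends it to all `y`, and `y = x` gives `x = 0`.
  have key : ∀ y, (‖y‖ / 4) ^ 2 ≤ ‖star y * y - star x * x‖ := fun y =>
    hd.induction_on (p := fun y => (‖y‖ / 4) ^ 2 ≤ ‖star y * y - star x * x‖) y
      (isClosed_le (by fun_prop) (by fun_prop)) fun a => by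
        refine (f3 a).trans ?_
        rw [← sub_zero (f a _), ← h0 a, ← map_sub]
        exact f1 a _
  have := key x
  rw [sub_self, norm_zero] at this
  have h4 : ‖x‖ / 4 = 0 := pow_eq_zero_iff two_ne_zero |>.1 (le_antisymm this (sq_nonneg _))
  exact norm_eq_zero.1 (by linarith)

/-- The GNS representation of a faithful positive functional is faithful. -/
lemma exists_faithful_hilbertRep (f : B →ₗ[ℂ] ℂ) (hf : ∀ x, 0 ≤ f (star x * x))
    (hf' : ∀ x, f (star x * x) = 0 → x = 0) : ∃ r : HilbertRep B, Function.Injective r.π := by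
  let _ : PartialOrder B := CStarAlgebra.spectralOrder B
  have _ : StarOrderedRing B := CStarAlgebra.spectralOrderedRing B
  let F : B →ₚ[ℂ] ℂ := PositiveLinearMap.mk₀ f fun x hx => by
    obtain ⟨y, rfl⟩ := CStarAlgebra.nonneg_iff_eq_star_mul_self.1 hx
    exact hf y
  refine ⟨⟨F.GNS, F.gnsNonUnitalStarAlgHom⟩, (injective_iff_map_eq_zero _).2 fun b hb => ?_⟩
  -- Without a unit to supply a cyclic vector, the operator of `b` is tested on the class of `b*`;
  -- this yields `b b* = 0`.
  have h1 : ‖F.leftMulMapPreGNS b (F.toPreGNS (star b))‖ = 0 := by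
    rw [← UniformSpace.Completion.norm_coe, ← F.gnsNonUnitalStarAlgHom_apply_coe]
    have hb' : F.gnsNonUnitalStarAlgHom b = 0 := hb
    rw [hb', zero_apply, norm_zero]
  have h2 := F.preGNS_norm_sq (F.leftMulMapPreGNS b (F.toPreGNS (star b)))
  rw [h1] at h2
  have h3 : b * star b = 0 := hf' _ (show F _ = 0 by simpa using h2.symm)
  exact (CStarRing.mul_star_self_eq_zero_iff b).1 h3

lemma IsMF.exists_faithful_hilbertRep (h : IsMF B) :
    ∃ r : HilbertRep B, Function.Injective r.π := by
  obtain ⟨f, hf, hf'⟩ := h.exists_faithful_functional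
  exact _root_.exists_faithful_hilbertRep f hf hf'

end FaithfulRep

/-! ### Operators on Hilbert space tensor products and their compressions -/

section Slice

open scoped InnerProductSpace

variable {H K : Type*} [NormedAddCommGroup H] [InnerProductSpace ℂ H]
  [NormedAddCommGroup K] [InnerProductSpace ℂ K]

section Amplification

variable [CompleteSpace K] {m : Type*} [Fintype m]

variable (K m) in
/-- The action of an operator matrix on the Hilbert space direct sum. -/
def matrixAction :
    CStarMatrix m m (K →L[ℂ] K) →⋆ₙₐ[ℂ] (PiLp 2 (fun _ : m => K) →L[ℂ] PiLp 2 (fun _ : m => K)) where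
  toFun M := (PiLp.continuousLinearEquiv 2 ℂ (fun _ : m => K)).symm.toContinuousLinearMap ∘L
    ContinuousLinearMap.pi fun s => ∑ t, M s t ∘L PiLp.proj 2 (fun _ : m => K) t
  map_zero' := by ext; simp
  map_add' M N := by ext; simp [Finset.sum_add_distrib]
  map_smul' c M := by ext; simp [Finset.smul_sum]
  map_mul' M N := by
    ext η s
    simp only [CStarMatrix.mul_apply, ContinuousLinearMap.comp_apply, mul_apply_eq_comp,
      ContinuousLinearEquiv.coe_coe, PiLp.coe_symm_continuousLinearEquiv,
      ContinuousLinearMap.pi_apply, sum_apply, PiLp.proj_apply, map_sum]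
    exact Finset.sum_comm
  map_star' M := by
    rw [ContinuousLinearMap.star_eq_adjoint, ContinuousLinearMap.eq_adjoint_iff]
    intro η ζ
    simp only [PiLp.inner_apply, ContinuousLinearMap.comp_apply, ContinuousLinearEquiv.coe_coe,
      PiLp.coe_symm_continuousLinearEquiv, ContinuousLinearMap.pi_apply,
      sum_apply, PiLp.proj_apply, sum_inner, inner_sum, CStarMatrix.star_apply,
      ContinuousLinearMap.star_eq_adjoint, ContinuousLinearMap.adjoint_inner_left]
    exact Finset.sum_comm

lemma matrixAction_apply (M : CStarMatrix m m (K →L[ℂ] K)) (η : PiLp 2 (fun _ : m => K)) (s : m) :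
    matrixAction K m M η s = ∑ t, M s t (η t) := by
  simp [matrixAction]

/-- Injectivity makes the action isometric, so norms of operator matrices can be tested on vectors.
-/
lemma matrixAction_injective : Function.Injective (matrixAction K m) := by
  classical
  intro M N h
  ext s t κ
  have h1 : ∀ M : CStarMatrix m m (K →L[ℂ] K),
      matrixAction K m M (WithLp.toLp 2 (Pi.single t κ)) s = M s t κ := fun M => by
    rw [matrixAction_apply, Finset.sum_eq_single t]
    · simp
    · intro u _ hu
      simp [hu]
    · simp
  rw [← h1 M, h, h1]

end Amplification

/-! ### Compression of `H ⊗ K` along a finite orthonormal family in `H`. -/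

variable {m : ℕ}

/-- The map `η ↦ ∑ₛ eₛ ⊗ ηₛ`. -/
def tensorFamily (e : Fin m → H) (η : PiLp 2 (fun _ : Fin m => K)) : H ⊗[ℂ] K :=
  ∑ s, e s ⊗ₜ[ℂ] η s

/-- The map `ξ ⊗ κ ↦ (⟪eₛ, ξ⟫ κ)ₛ`. -/
def tensorCoords (e : Fin m → H) (y : H ⊗[ℂ] K) : PiLp 2 (fun _ : Fin m => K) :=
  WithLp.toLp 2 fun s => TensorProduct.lid ℂ K (LinearMap.rTensor K (innerₛₗ ℂ (e s)) y)

lemma tensorCoords_tmul (e : Fin m → H) (ξ : H) (κ : K) (s : Fin m) :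
    tensorCoords e (ξ ⊗ₜ[ℂ] κ) s = ⟪e s, ξ⟫_ℂ • κ := by
  simp [tensorCoords]

lemma tensorCoords_add (e : Fin m → H) (x y : H ⊗[ℂ] K) :
    tensorCoords e (x + y) = tensorCoords e x + tensorCoords e y := by
  ext s
  simp [tensorCoords]

lemma tensorFamily_add (e : Fin m → H) (x y : PiLp 2 (fun _ : Fin m => K)) :
    tensorFamily e (x + y) = tensorFamily e x + tensorFamily e y := by
  simp [tensorFamily, TensorProduct.tmul_add, Finset.sum_add_distrib]

lemma norm_inner_tensorProduct_le (x y : H ⊗[ℂ] K) : ‖⟪x, y⟫_ℂ‖ ≤ ‖x‖ * ‖y‖ :=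
  norm_inner_le_norm (𝕜 := ℂ) x y

/-- `tensorFamily e` and `tensorCoords e` are mutually adjoint. For orthonormal `e` the former is an
isometry `V` from `K^m`, the latter is `V*`, and `V V*` is `P ⊗ 1` with `P` the projection onto the
span of `e`. -/
lemma inner_tensorFamily_left (e : Fin m → H) (η : PiLp 2 (fun _ : Fin m => K)) (y : H ⊗[ℂ] K) :
    ⟪tensorFamily e η, y⟫_ℂ = ⟪η, tensorCoords e y⟫_ℂ := by
  induction y with
  | zero => simp [tensorCoords, PiLp.inner_apply]
  | add x y hx hy => rw [inner_add_right, hx, hy, tensorCoords_add, inner_add_right]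
  | tmul ξ κ =>
    simp [tensorFamily, PiLp.inner_apply, sum_inner, tensorCoords_tmul, inner_smul_right]

lemma tensorFamily_coords_tmul (e : Fin m → H) (ξ : H) (κ : K) :
    tensorFamily e (tensorCoords e (ξ ⊗ₜ[ℂ] κ)) = (∑ s, ⟪e s, ξ⟫_ℂ • e s) ⊗ₜ[ℂ] κ := by
  simp [tensorFamily, tensorCoords_tmul, TensorProduct.sum_tmul, TensorProduct.smul_tmul]

lemma Orthonormal.tensorCoords_tensorFamily {e : Fin m → H} (he : Orthonormal ℂ e)
    (η : PiLp 2 (fun _ : Fin m => K)) : tensorCoords e (tensorFamily e η) = η := by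
  ext s
  simp [tensorCoords, tensorFamily, orthonormal_iff_ite.1 he, ite_smul]

lemma Orthonormal.norm_tensorFamily {e : Fin m → H} (he : Orthonormal ℂ e)
    (η : PiLp 2 (fun _ : Fin m => K)) : ‖tensorFamily e η‖ = ‖η‖ := by
  rw [@norm_eq_sqrt_re_inner ℂ, inner_tensorFamily_left, he.tensorCoords_tensorFamily,
    ← @norm_eq_sqrt_re_inner ℂ]

lemma Orthonormal.norm_tensorCoords_le {e : Fin m → H} (he : Orthonormal ℂ e) (y : H ⊗[ℂ] K) :
    ‖tensorCoords e y‖ ≤ ‖y‖ := by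
  rcases (norm_nonneg (tensorCoords e y)).eq_or_lt with h | h
  · rw [← h]
    exact norm_nonneg _
  · refine le_of_mul_le_mul_left ?_ h
    calc ‖tensorCoords e y‖ * ‖tensorCoords e y‖
        = RCLike.re ⟪tensorFamily e (tensorCoords e y), y⟫_ℂ := by
          rw [inner_tensorFamily_left, inner_self_eq_norm_mul_norm]
      _ ≤ ‖tensorFamily e (tensorCoords e y)‖ * ‖y‖ :=
          (Complex.re_le_norm _).trans (norm_inner_tensorProduct_le _ _)
      _ = _ := by rw [he.norm_tensorFamily]

section SliceDef

variable {D : Type*} [NonUnitalCStarAlgebra D]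

/-- The compression `S ⊗ d ↦ (⟪eₛ, S eₜ⟫ d)ₛₜ`. -/
def slice (e : Fin m → H) : (H →L[ℂ] H) ⊗[ℂ] D →ₗ[ℂ] CStarMatrix (Fin m) (Fin m) D where
  toFun T := CStarMatrix.ofMatrix fun s t => TensorProduct.lid ℂ D (LinearMap.rTensor D
    (innerₛₗ ℂ (e s) ∘ₗ (ContinuousLinearMap.apply ℂ H (e t)).toLinearMap) T)
  map_add' T T' := by
    ext s t
    simp only [map_add]
    rfl
  map_smul' c T := by
    ext s t
    simp only [map_smul]
    rfl

lemma slice_tmul (e : Fin m → H) (S : H →L[ℂ] H) (d : D) (s t : Fin m) :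
    slice e (S ⊗ₜ[ℂ] d) s t = ⟪e s, S (e t)⟫_ℂ • d := by
  change TensorProduct.lid ℂ D (LinearMap.rTensor D _ (S ⊗ₜ[ℂ] d)) = _
  simp

/-- Slicing touches only the first factor. With `ρ` injective, norms of slices can therefore be
computed after representing the second factor. -/
lemma slice_lTensor {D' : Type*} [NonUnitalCStarAlgebra D'] (e : Fin m → H) (ρ : D →⋆ₙₐ[ℂ] D')
    (T : (H →L[ℂ] H) ⊗[ℂ] D) :
    slice e (LinearMap.lTensor _ (ρ : D →ₗ[ℂ] D') T) = CStarMatrix.mapₙₐ ρ (slice e T) := by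
  induction T with
  | zero => rw [map_zero, map_zero, map_zero, map_zero]
  | add x y hx hy => rw [map_add, map_add, hx, hy, map_add, map_add]
  | tmul S d =>
    ext s t
    rw [LinearMap.lTensor_tmul, slice_tmul]
    change _ = ρ (slice e (S ⊗ₜ[ℂ] d) s t)
    rw [slice_tmul, map_smul]
    rfl

end SliceDef

/-- The operator on the algebraic tensor product of Hilbert spaces given by a tensor of
operators. -/
def tensorOperator : (H →L[ℂ] H) ⊗[ℂ] (K →L[ℂ] K) →ₗ[ℂ] (H ⊗[ℂ] K →L[ℂ] H ⊗[ℂ] K) :=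
  TensorProduct.lift (LinearMap.mk₂ ℂ TensorProduct.mapL TensorProduct.mapL_add_left
    TensorProduct.mapL_smul_left TensorProduct.mapL_add_right TensorProduct.mapL_smul_right)

lemma tensorOperator_tmul (S : H →L[ℂ] H) (R : K →L[ℂ] K) :
    tensorOperator (S ⊗ₜ[ℂ] R) = TensorProduct.mapL S R := by
  simp [tensorOperator]

variable [CompleteSpace K]

/-- This identifies the slice of `T` with the compression `V* T V`, where `V` is `tensorFamily e`.
-/
lemma inner_tensorOperator_tensorFamily (e : Fin m → H) (T : (H →L[ℂ] H) ⊗[ℂ] (K →L[ℂ] K))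
    (η ζ : PiLp 2 (fun _ : Fin m => K)) :
    ⟪tensorFamily e η, tensorOperator T (tensorFamily e ζ)⟫_ℂ =
      ⟪η, matrixAction K (Fin m) (slice e T) ζ⟫_ℂ := by
  induction T with
  | zero => simp
  | add x y hx hy =>
    rw [map_add, map_add, map_add, add_apply, add_apply, inner_add_right, inner_add_right, hx, hy]
  | tmul S R =>
    simp [tensorFamily, PiLp.inner_apply, sum_inner, inner_sum, tensorOperator_tmul,
      matrixAction_apply, slice_tmul, inner_smul_right]
    exact Finset.sum_comm

lemma Orthonormal.norm_slice_le {e : Fin m → H} (he : Orthonormal ℂ e)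
    (T : (H →L[ℂ] H) ⊗[ℂ] (K →L[ℂ] K)) : ‖slice e T‖ ≤ ‖tensorOperator T‖ := by
  rw [← NonUnitalStarAlgHom.norm_map (matrixAction K (Fin m)) matrixAction_injective]
  refine ContinuousLinearMap.opNorm_le_of_re_inner_le (norm_nonneg (tensorOperator T))
    fun ζ η hζ hη => ?_
  calc _ ≤ ‖⟪η, matrixAction K (Fin m) (slice e T) ζ⟫_ℂ‖ := by
        rw [inner_re_symm]
        exact RCLike.re_le_norm _
    _ ≤ ‖tensorFamily e η‖ * (‖tensorOperator T‖ * ‖tensorFamily e ζ‖) := by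
        rw [← inner_tensorOperator_tensorFamily]
        refine (norm_inner_tensorProduct_le _ _).trans ?_
        gcongr
        exact (tensorOperator T).le_opNorm _
    _ = ‖tensorOperator T‖ := by
        rw [he.norm_tensorFamily, he.norm_tensorFamily, hζ, hη, mul_one, one_mul]

/-- If the projections `Pᵢ` tend strongly to `1`, then `⟪z, T y⟫` is the limit of `⟪(Pᵢ ⊗ 1) z, T
(Pᵢ ⊗ 1) y⟫`, which the norms of the slices bound. As the limit exists, a frequent bound suffices.
-/
lemma norm_tensorOperator_le_of_frequently {ι : Type*} {l : Filter ι} {m : ι → ℕ}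
    {e : ∀ i, Fin (m i) → H} (he : ∀ i, Orthonormal ℂ (e i))
    (hP : ∀ ξ, Tendsto (fun i => ∑ s, ⟪e i s, ξ⟫_ℂ • e i s) l (𝓝 ξ))
    (T : (H →L[ℂ] H) ⊗[ℂ] (K →L[ℂ] K)) {r : ℝ} (hr : ∃ᶠ i in l, ‖slice (e i) T‖ ≤ r) :
    ‖tensorOperator T‖ ≤ r := by
  have hr0 : 0 ≤ r := by
    obtain ⟨i, hi⟩ := hr.exists
    exact (norm_nonneg _).trans hi
  have hlim : ∀ y : H ⊗[ℂ] K,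
      Tendsto (fun i => tensorFamily (e i) (tensorCoords (e i) y)) l (𝓝 y) := fun y => by
    induction y with
    | zero => simpa [tensorFamily, tensorCoords] using tendsto_const_nhds
    | add x y hx hy => simpa [tensorCoords_add, tensorFamily_add] using hx.add hy
    | tmul ξ κ =>
      simp only [tensorFamily_coords_tmul]
      exact TensorProduct.continuous_tmul.tendsto (ξ, κ) |>.comp
        ((hP ξ).prodMk_nhds tendsto_const_nhds)
  have key : ∀ z y : H ⊗[ℂ] K, ‖⟪z, tensorOperator T y⟫_ℂ‖ ≤ r * ‖z‖ * ‖y‖ := fun z y => by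
    refine le_of_tendsto_of_frequently (((hlim z).inner
      (((tensorOperator T).continuous.tendsto y).comp (hlim y))).norm) (hr.mono fun i hi => ?_)
    rw [Function.comp_apply, inner_tensorOperator_tensorFamily]
    calc _ ≤ ‖tensorCoords (e i) z‖ *
          ‖matrixAction K (Fin (m i)) (slice (e i) T) (tensorCoords (e i) y)‖ :=
          norm_inner_le_norm _ _
      _ ≤ ‖z‖ * (r * ‖y‖) := by
        gcongr
        · exact (he i).norm_tensorCoords_le z
        · refine (ContinuousLinearMap.le_opNorm _ _).trans ?_
          gcongr
          · exact (NonUnitalStarAlgHom.norm_apply_le _ _).trans hi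
          · exact (he i).norm_tensorCoords_le y
      _ = r * ‖z‖ * ‖y‖ := by ring
  refine ContinuousLinearMap.opNorm_le_of_re_inner_le hr0 fun y z hy hz => ?_
  have := key z y
  rw [hy, hz, mul_one, mul_one] at this
  rw [inner_re_symm]
  exact (RCLike.re_le_norm _).trans this

/-- Replacing a representation of the second factor by a faithful one increases the norm. -/
lemma norm_tensorOperator_lTensor_le {K₀ B : Type*} [NormedAddCommGroup K₀]
    [InnerProductSpace ℂ K₀] [CompleteSpace K₀] [NonUnitalCStarAlgebra B]
    (ρ : B →⋆ₙₐ[ℂ] (K →L[ℂ] K)) (ρ₀ : B →⋆ₙₐ[ℂ] (K₀ →L[ℂ] K₀)) (h₀ : Function.Injective ρ₀)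
    (T : (H →L[ℂ] H) ⊗[ℂ] B) :
    ‖tensorOperator (LinearMap.lTensor _ (ρ : B →ₗ[ℂ] (K →L[ℂ] K)) T)‖ ≤
      ‖tensorOperator (LinearMap.lTensor _ (ρ₀ : B →ₗ[ℂ] (K₀ →L[ℂ] K₀)) T)‖ := by
  let _ : PartialOrder B := CStarAlgebra.spectralOrder B
  have _ : StarOrderedRing B := CStarAlgebra.spectralOrderedRing B
  -- The spans of finite subsets, directed by inclusion, give projections that eventually fix each
  -- vector. On each slice `ρ` is contractive and `ρ₀` isometric.
  let V : Finset H → Submodule ℂ H := fun F => Submodule.span ℂ (F : Set H)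
  let e : ∀ F : Finset H, Fin (Module.finrank ℂ (V F)) → H := fun F s =>
    (stdOrthonormalBasis ℂ (V F) s : H)
  have he : ∀ F, Orthonormal ℂ (e F) := fun F =>
    (stdOrthonormalBasis ℂ (V F)).orthonormal.comp_linearIsometry (V F).subtypeₗᵢ
  refine norm_tensorOperator_le_of_frequently (l := atTop) he (fun ξ => ?_) _
    (Eventually.frequently (.of_forall fun F => ?_))
  · refine tendsto_const_nhds.congr' ?_
    filter_upwards [eventually_ge_atTop {ξ}] with F hF
    have hξ : ξ ∈ V F := Submodule.subset_span (by simpa using hF)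
    have := congrArg ((↑) : V F → H) ((stdOrthonormalBasis ℂ (V F)).sum_repr' ⟨ξ, hξ⟩)
    simpa [e] using this.symm
  · rw [slice_lTensor]
    refine (NonUnitalStarAlgHom.norm_apply_le _ _).trans ?_
    rw [← CStarMatrix.norm_mapₙₐ ρ₀ h₀, ← slice_lTensor]
    exact (he F).norm_slice_le _

omit [CompleteSpace K] in
-- The flip of Hilbert spaces is isometric and intertwines the two operators. It transfers the
-- comparison of representations from the second factor to the first.
lemma norm_tensorOperator_comm (T : (H →L[ℂ] H) ⊗[ℂ] (K →L[ℂ] K)) :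
    ‖tensorOperator (TensorProduct.comm ℂ _ _ T)‖ = ‖tensorOperator T‖ := by
  have h : ∀ y, tensorOperator (TensorProduct.comm ℂ _ _ T) (TensorProduct.comm ℂ H K y) =
      TensorProduct.comm ℂ H K (tensorOperator T y) := fun y => by
    induction T with
    | zero =>
      rw [LinearEquiv.map_zero, LinearMap.map_zero, LinearMap.map_zero, zero_apply, zero_apply,
        LinearEquiv.map_zero]
    | add S R hS hR =>
      rw [LinearEquiv.map_add, LinearMap.map_add, LinearMap.map_add, add_apply, add_apply,
        LinearEquiv.map_add, hS, hR]
    | tmul S R =>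
      rw [TensorProduct.comm_tmul, tensorOperator_tmul, tensorOperator_tmul]
      induction y with
      | zero => simp
      | add S R hS hR => simp only [map_add, hS, hR]
      | tmul ξ κ => simp
  refine le_antisymm (ContinuousLinearMap.opNorm_le_bound _ (norm_nonneg (tensorOperator T))
    fun y => ?_) (ContinuousLinearMap.opNorm_le_bound _
      (norm_nonneg (tensorOperator (TensorProduct.comm ℂ _ _ T))) fun y => ?_)
  · obtain ⟨y, rfl⟩ := (TensorProduct.comm ℂ H K).surjective y
    rw [h, TensorProduct.norm_comm, TensorProduct.norm_comm]
    exact (tensorOperator T).le_opNorm _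
  · rw [← TensorProduct.norm_comm, ← h, ← TensorProduct.norm_comm y]
    exact (tensorOperator (TensorProduct.comm ℂ _ _ T)).le_opNorm _

/-- The operator norm for a pair of representations is largest for a faithful pair. -/
lemma norm_tensorOperator_map_le [CompleteSpace H] {H₀ K₀ A B : Type*}
    [NormedAddCommGroup H₀] [InnerProductSpace ℂ H₀] [CompleteSpace H₀]
    [NormedAddCommGroup K₀] [InnerProductSpace ℂ K₀] [CompleteSpace K₀]
    [NonUnitalCStarAlgebra A] [NonUnitalCStarAlgebra B]
    (σ : A →⋆ₙₐ[ℂ] (H →L[ℂ] H)) (σ₀ : A →⋆ₙₐ[ℂ] (H₀ →L[ℂ] H₀)) (hσ₀ : Function.Injective σ₀)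
    (ρ : B →⋆ₙₐ[ℂ] (K →L[ℂ] K)) (ρ₀ : B →⋆ₙₐ[ℂ] (K₀ →L[ℂ] K₀)) (hρ₀ : Function.Injective ρ₀)
    (x : A ⊗[ℂ] B) :
    ‖tensorOperator (TensorProduct.map (σ : A →ₗ[ℂ] (H →L[ℂ] H)) (ρ : B →ₗ[ℂ] (K →L[ℂ] K)) x)‖ ≤
      ‖tensorOperator (TensorProduct.map (σ₀ : A →ₗ[ℂ] (H₀ →L[ℂ] H₀))
        (ρ₀ : B →ₗ[ℂ] (K₀ →L[ℂ] K₀)) x)‖ := by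
  calc _ ≤ ‖tensorOperator (TensorProduct.map (σ : A →ₗ[ℂ] (H →L[ℂ] H))
        (ρ₀ : B →ₗ[ℂ] (K₀ →L[ℂ] K₀)) x)‖ := by
        rw [← LinearMap.lTensor_comp_rTensor, ← LinearMap.lTensor_comp_rTensor]
        exact norm_tensorOperator_lTensor_le ρ ρ₀ hρ₀ _
    _ ≤ _ := by
        rw [← norm_tensorOperator_comm, ← norm_tensorOperator_comm (H := H₀),
          ← TensorProduct.map_comm, ← TensorProduct.map_comm, ← LinearMap.lTensor_comp_rTensor,
          ← LinearMap.lTensor_comp_rTensor]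
        exact norm_tensorOperator_lTensor_le σ σ₀ hσ₀ _

end Slice

/-! ### The algebraic tensor product inside the minimal tensor product -/

section Completion

variable {X : Type*} [NormedAddCommGroup X] [NormedSpace ℂ X]

lemma ContinuousLinearMap.completion_add (f g : X →L[ℂ] X) :
    (f + g).completion = f.completion + g.completion := by
  ext x
  induction x using UniformSpace.Completion.induction_on with
  | hp => exact isClosed_eq (by fun_prop) (by fun_prop)
  | ih x => simp [UniformSpace.Completion.coe_add]

lemma ContinuousLinearMap.completion_smul (c : ℂ) (f : X →L[ℂ] X) :
    (c • f).completion = c • f.completion := by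
  ext x
  induction x using UniformSpace.Completion.induction_on with
  | hp => exact isClosed_eq (c • f).completion.continuous (f.completion.continuous.const_smul c)
  | ih x => simp [UniformSpace.Completion.coe_smul]

lemma ContinuousLinearMap.completion_zero : (0 : X →L[ℂ] X).completion = 0 := by
  simpa using ContinuousLinearMap.completion_smul (0 : ℂ) (0 : X →L[ℂ] X)

lemma ContinuousLinearMap.norm_completion (f : X →L[ℂ] X) : ‖f.completion‖ = ‖f‖ := by
  refine le_antisymm (ContinuousLinearMap.opNorm_le_bound _ (norm_nonneg f) fun x => ?_)
    (ContinuousLinearMap.opNorm_le_bound _ (norm_nonneg f.completion) fun x => ?_)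
  · induction x using UniformSpace.Completion.induction_on with
    | hp => exact isClosed_le (by fun_prop) (by fun_prop)
    | ih x => simpa using f.le_opNorm x
  · simpa using f.completion.le_opNorm x

end Completion

section AlgTensor

variable {H K : Type*} [NormedAddCommGroup H] [InnerProductSpace ℂ H]
  [NormedAddCommGroup K] [InnerProductSpace ℂ K]

lemma opTensor_mul (S S' : H →L[ℂ] H) (R R' : K →L[ℂ] K) :
    opTensor (S * S') (R * R') = opTensor S R * opTensor S' R' := by
  ext x
  induction x using UniformSpace.Completion.induction_on with
  | hp => exact isClosed_eq (by fun_prop) (by fun_prop)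
  | ih x =>
    rw [mul_apply_eq_comp, opTensor, opTensor, opTensor,
      ContinuousLinearMap.completion_apply_coe, ContinuousLinearMap.completion_apply_coe,
      ContinuousLinearMap.completion_apply_coe, TensorProduct.mapL_mul, mul_apply_eq_comp]

lemma inner_mapL_left [CompleteSpace H] [CompleteSpace K] (S : H →L[ℂ] H) (R : K →L[ℂ] K)
    (x y : H ⊗[ℂ] K) : inner ℂ (TensorProduct.mapL (star S) (star R) x) y =
      inner ℂ x (TensorProduct.mapL S R y) := by
  induction x with
  | zero => rw [map_zero, inner_zero_left, inner_zero_left]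
  | add x x' hx hx' => rw [map_add, inner_add_left, inner_add_left, hx, hx']
  | tmul ξ κ =>
    induction y with
    | zero => rw [map_zero, inner_zero_right, inner_zero_right]
    | add y y' hy hy' => rw [map_add, inner_add_right, inner_add_right, hy, hy']
    | tmul ξ' κ' =>
      rw [TensorProduct.mapL_tmul, TensorProduct.mapL_tmul, TensorProduct.inner_tmul,
        TensorProduct.inner_tmul, ContinuousLinearMap.star_eq_adjoint,
        ContinuousLinearMap.star_eq_adjoint, ContinuousLinearMap.adjoint_inner_left,
        ContinuousLinearMap.adjoint_inner_left]

lemma opTensor_star [CompleteSpace H] [CompleteSpace K] (S : H →L[ℂ] H) (R : K →L[ℂ] K) :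
    opTensor (star S) (star R) = star (opTensor S R) := by
  rw [ContinuousLinearMap.star_eq_adjoint (opTensor S R), ContinuousLinearMap.eq_adjoint_iff]
  intro x y
  induction x, y using UniformSpace.Completion.induction_on₂ with
  | hp => exact isClosed_eq (by fun_prop) (by fun_prop)
  | ih x y =>
    rw [opTensor, opTensor, ContinuousLinearMap.completion_apply_coe,
      ContinuousLinearMap.completion_apply_coe, UniformSpace.Completion.inner_coe,
      UniformSpace.Completion.inner_coe, inner_mapL_left]

variable {A : Type u} [NonUnitalCStarAlgebra A] {B : Type v} [NonUnitalCStarAlgebra B]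

lemma elemTensor_apply (a : A) (b : B) (r : HilbertRep A × HilbertRep B) :
    elemTensor a b r = opTensor (r.1.π a) (r.2.π b) := rfl

lemma elemTensor_mul (a a' : A) (b b' : B) :
    elemTensor a b * elemTensor a' b' = elemTensor (a * a') (b * b') := by
  ext1
  funext r
  rw [lp.infty_coeFn_mul, Pi.mul_apply, elemTensor_apply, elemTensor_apply, elemTensor_apply,
    map_mul, map_mul, opTensor_mul]
  rfl

lemma elemTensor_star (a : A) (b : B) :
    star (elemTensor a b) = elemTensor (star a) (star b) := by
  ext1
  funext r
  rw [lp.star_apply, elemTensor_apply, elemTensor_apply, map_star, map_star, opTensor_star]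
  rfl

lemma norm_elemTensor_le (a : A) (b : B) : ‖elemTensor a b‖ ≤ ‖a‖ * ‖b‖ :=
  lp.norm_le_of_forall_le (by positivity) fun r => (norm_opTensor_le _ _).trans
    (mul_le_mul (NonUnitalStarAlgHom.norm_apply_le r.1.π a)
      (NonUnitalStarAlgHom.norm_apply_le r.2.π b) (norm_nonneg _) (norm_nonneg _))

variable (A B) in
/-- The bilinear map `(a, b) ↦ a ⊗ b`. -/
def elemTensorBilin : A →ₗ[ℂ] B →ₗ[ℂ] RepProduct A B :=
  LinearMap.mk₂ ℂ elemTensor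
    (fun a a' b => by
      ext1
      funext r
      rw [lp.coeFn_add, Pi.add_apply, elemTensor_apply, elemTensor_apply, elemTensor_apply,
        map_add, opTensor, TensorProduct.mapL_add_left, ContinuousLinearMap.completion_add]
      rfl)
    (fun c a b => by
      ext1
      funext r
      rw [lp.coeFn_smul, Pi.smul_apply, elemTensor_apply, elemTensor_apply,
        map_smul, opTensor, TensorProduct.mapL_smul_left, ContinuousLinearMap.completion_smul]
      rfl)
    (fun a b b' => by
      ext1
      funext r
      rw [lp.coeFn_add, Pi.add_apply, elemTensor_apply, elemTensor_apply, elemTensor_apply,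
        map_add, opTensor, TensorProduct.mapL_add_right, ContinuousLinearMap.completion_add]
      rfl)
    (fun c a b => by
      ext1
      funext r
      rw [lp.coeFn_smul, Pi.smul_apply, elemTensor_apply, elemTensor_apply,
        map_smul, opTensor, TensorProduct.mapL_smul_right, ContinuousLinearMap.completion_smul]
      rfl)

variable (A B) in
/-- The canonical map from the algebraic tensor product. -/
def algTensor : A ⊗[ℂ] B →ₗ[ℂ] RepProduct A B := TensorProduct.lift (elemTensorBilin A B)

lemma algTensor_tmul (a : A) (b : B) : algTensor A B (a ⊗ₜ[ℂ] b) = elemTensor a b := by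
  rw [algTensor, TensorProduct.lift.tmul]
  rfl

lemma algTensor_apply (x : A ⊗[ℂ] B) (r : HilbertRep A × HilbertRep B) :
    algTensor A B x r = (tensorOperator (TensorProduct.map
      (r.1.π : A →ₗ[ℂ] (r.1.H →L[ℂ] r.1.H)) (r.2.π : B →ₗ[ℂ] (r.2.H →L[ℂ] r.2.H)) x)
        ).completion := by
  induction x with
  | zero =>
    rw [map_zero, map_zero, map_zero, ContinuousLinearMap.completion_zero]
    rfl
  | add x y hx hy =>
    rw [map_add, map_add, map_add, ContinuousLinearMap.completion_add, ← hx, ← hy]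
    rfl
  | tmul a b =>
    rw [algTensor_tmul, TensorProduct.map_tmul, tensorOperator_tmul]
    rfl

/-- The minimal norm is computed by any pair of faithful representations. -/
lemma norm_algTensor (x : A ⊗[ℂ] B) (r : HilbertRep A × HilbertRep B)
    (h₁ : Function.Injective r.1.π) (h₂ : Function.Injective r.2.π) :
    ‖algTensor A B x‖ = ‖tensorOperator (TensorProduct.map
      (r.1.π : A →ₗ[ℂ] (r.1.H →L[ℂ] r.1.H)) (r.2.π : B →ₗ[ℂ] (r.2.H →L[ℂ] r.2.H)) x)‖ := by
  have h : ∀ r : HilbertRep A × HilbertRep B, ‖algTensor A B x r‖ = ‖tensorOperator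
      (TensorProduct.map (r.1.π : A →ₗ[ℂ] (r.1.H →L[ℂ] r.1.H))
        (r.2.π : B →ₗ[ℂ] (r.2.H →L[ℂ] r.2.H)) x)‖ := fun r => by
    rw [algTensor_apply]
    exact ContinuousLinearMap.norm_completion _
  refine le_antisymm (lp.norm_le_of_forall_le (norm_nonneg (tensorOperator _)) fun r' => ?_) ?_
  · rw [h]
    exact norm_tensorOperator_map_le _ _ h₁ _ _ h₂ x
  · rw [← h]
    exact lp.norm_apply_le_norm ENNReal.top_ne_zero _ r

lemma algTensor_mem (x : A ⊗[ℂ] B) : algTensor A B x ∈ MinTensor A B := by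
  refine NonUnitalStarSubalgebra.le_topologicalClosure _ ?_
  induction x with
  | zero => rw [map_zero]; exact zero_mem _
  | add x y hx hy => rw [map_add]; exact add_mem hx hy
  | tmul a b =>
    rw [algTensor_tmul]
    exact NonUnitalStarAlgebra.subset_adjoin ℂ _ ⟨a, b, rfl⟩

variable (A B) in
/-- The canonical map from the algebraic to the minimal tensor product. -/
def toMinTensor : A ⊗[ℂ] B →ₗ[ℂ] MinTensor A B where
  toFun x := ⟨algTensor A B x, algTensor_mem x⟩
  map_add' x y := Subtype.ext (map_add _ x y)
  map_smul' c x := Subtype.ext (map_smul _ c x)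

lemma toMinTensor_mul_tmul (a a' : A) (b b' : B) :
    toMinTensor A B (a ⊗ₜ b) * toMinTensor A B (a' ⊗ₜ b') =
      toMinTensor A B ((a * a') ⊗ₜ (b * b')) := by
  refine Subtype.ext ?_
  change algTensor A B (a ⊗ₜ b) * algTensor A B (a' ⊗ₜ b') = algTensor A B ((a * a') ⊗ₜ (b * b'))
  rw [algTensor_tmul, algTensor_tmul, algTensor_tmul, elemTensor_mul]

lemma star_toMinTensor_tmul (a : A) (b : B) :
    star (toMinTensor A B (a ⊗ₜ b)) = toMinTensor A B (star a ⊗ₜ star b) := by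
  refine Subtype.ext ?_
  change star (algTensor A B (a ⊗ₜ b)) = algTensor A B (star a ⊗ₜ star b)
  rw [algTensor_tmul, algTensor_tmul, elemTensor_star]

lemma toMinTensor_mul_mem_range (x y : A ⊗[ℂ] B) :
    toMinTensor A B x * toMinTensor A B y ∈ LinearMap.range (toMinTensor A B) := by
  induction x with
  | zero => rw [map_zero, zero_mul]; exact zero_mem _
  | add x x' hx hx' => rw [map_add, add_mul]; exact add_mem hx hx'
  | tmul a b =>
    induction y with
    | zero => rw [map_zero, mul_zero]; exact zero_mem _
    | add y y' hy hy' => rw [map_add, mul_add]; exact add_mem hy hy'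
    | tmul a' b' => rw [toMinTensor_mul_tmul]; exact ⟨_, rfl⟩

lemma star_toMinTensor_mem_range (x : A ⊗[ℂ] B) :
    star (toMinTensor A B x) ∈ LinearMap.range (toMinTensor A B) := by
  induction x with
  | zero => rw [map_zero, star_zero]; exact zero_mem _
  | add x x' hx hx' => rw [map_add, star_add]; exact add_mem hx hx'
  | tmul a b => rw [star_toMinTensor_tmul]; exact ⟨_, rfl⟩

/-- The image of the algebraic tensor product is already closed under products and the involution,
so adjoining the elementary tensors produces nothing more. -/
lemma denseRange_toMinTensor : DenseRange (toMinTensor A B) := by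
  have h : ∀ z ∈ NonUnitalStarAlgebra.adjoin ℂ {x : RepProduct A B | ∃ a b, x = elemTensor a b},
      ∃ x, algTensor A B x = z := fun z hz => by
    induction hz using NonUnitalStarAlgebra.adjoin_induction with
    | mem z hz =>
      obtain ⟨a, b, rfl⟩ := hz
      exact ⟨a ⊗ₜ b, algTensor_tmul a b⟩
    | add z w _ _ hz hw =>
      obtain ⟨x, rfl⟩ := hz
      obtain ⟨y, rfl⟩ := hw
      exact ⟨x + y, map_add _ x y⟩
    | zero => exact ⟨0, map_zero _⟩
    | mul z w _ _ hz hw =>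
      obtain ⟨x, rfl⟩ := hz
      obtain ⟨y, rfl⟩ := hw
      obtain ⟨u, hu⟩ := toMinTensor_mul_mem_range x y
      exact ⟨u, congrArg Subtype.val hu⟩
    | smul c z _ hz =>
      obtain ⟨x, rfl⟩ := hz
      exact ⟨c • x, map_smul _ c x⟩
    | star z _ hz =>
      obtain ⟨x, rfl⟩ := hz
      obtain ⟨u, hu⟩ := star_toMinTensor_mem_range x
      exact ⟨u, congrArg Subtype.val hu⟩
  intro z
  rw [Topology.IsInducing.subtypeVal.closure_eq_preimage_closure_image]
  refine closure_mono ?_ z.2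
  intro w hw
  obtain ⟨x, rfl⟩ := h w hw
  exact ⟨toMinTensor A B x, ⟨x, rfl⟩, rfl⟩

lemma separableSpace_minTensor [TopologicalSpace.SeparableSpace A]
    [TopologicalSpace.SeparableSpace B] : TopologicalSpace.SeparableSpace (MinTensor A B) := by
  -- Boundedness makes the elementary tensors a continuous image of the separable space `A × B`;
  -- their span is dense.
  let β : A →L[ℂ] B →L[ℂ] MinTensor A B :=
    (((TensorProduct.mk ℂ A B).compr₂ (toMinTensor A B)).mkContinuous₂ 1 fun a b => by
      rw [one_mul]
      refine le_trans (le_of_eq ?_) (norm_elemTensor_le a b)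
      rw [← algTensor_tmul]
      rfl)
  have hβ : Continuous fun q : A × B => β q.1 q.2 := by fun_prop
  have h1 : TopologicalSpace.IsSeparable (Set.range fun q : A × B => β q.1 q.2) :=
    TopologicalSpace.isSeparable_range hβ
  have h2 := (h1.span (R := ℂ)).closure
  rw [← TopologicalSpace.isSeparable_univ_iff]
  refine h2.mono fun z _ => ?_
  refine closure_mono ?_ (denseRange_toMinTensor z)
  rintro _ ⟨x, rfl⟩
  induction x with
  | zero => rw [map_zero]; exact zero_mem _
  | add x y hx hy => rw [map_add]; exact add_mem hx hy
  | tmul a b => exact Submodule.subset_span ⟨(a, b), rfl⟩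

end AlgTensor

/-! ### Compressing along the projections of a quasidiagonal representation -/

section Quasidiagonal

open scoped InnerProductSpace

lemma exists_orthonormal_of_isStarProjection {H : Type*} [NormedAddCommGroup H]
    [InnerProductSpace ℂ H] [CompleteSpace H] {p : H →L[ℂ] H} (hp : IsStarProjection p)
    (hfin : FiniteDimensional ℂ p.range) :
    ∃ (m : ℕ) (e : Fin m → H), Orthonormal ℂ e ∧ (∀ s, p (e s) = e s) ∧
      ∀ ξ, ∑ s, ⟪e s, ξ⟫_ℂ • e s = p ξ := by
  let V : Submodule ℂ H := p.range
  let b := stdOrthonormalBasis ℂ V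
  have hpe : ∀ s, p (b s : H) = b s := fun s => by
    obtain ⟨ξ, hξ⟩ := (b s).2
    have hξ' : p ξ = b s := hξ
    rw [← hξ', ← mul_apply_eq_comp, hp.isIdempotentElem.eq]
  have hsa : ∀ ξ ζ, ⟪p ξ, ζ⟫_ℂ = ⟪ξ, p ζ⟫_ℂ := fun ξ ζ => by
    rw [← ContinuousLinearMap.adjoint_inner_right, ← ContinuousLinearMap.star_eq_adjoint,
      hp.isSelfAdjoint.star_eq]
  refine ⟨_, fun s => (b s : H), b.orthonormal.comp_linearIsometry V.subtypeₗᵢ, hpe, fun ξ => ?_⟩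
  have h := congrArg ((↑) : V → H) (b.sum_repr' ⟨p ξ, ξ, rfl⟩)
  rw [AddSubmonoidClass.coe_finsetSum] at h
  refine Eq.trans (Finset.sum_congr rfl fun s _ => ?_) h
  have h1 : ⟪b s, (⟨p ξ, ξ, rfl⟩ : V)⟫_ℂ = ⟪(b s : H), p ξ⟫_ℂ := rfl
  rw [h1, ← hsa, hpe]
  rfl

variable {A : Type u} [NonUnitalCStarAlgebra A] {B : Type v} [NonUnitalCStarAlgebra B]

/-- The compression `a ⊗ b ↦ (⟪eₛ, π(a) eₜ⟫ b)ₛₜ`. -/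
def repSlice (r : HilbertRep A) {m : ℕ} (e : Fin m → r.H) :
    A ⊗[ℂ] B →ₗ[ℂ] CStarMatrix (Fin m) (Fin m) B :=
  slice e ∘ₗ LinearMap.rTensor B (r.π : A →ₗ[ℂ] (r.H →L[ℂ] r.H))

lemma repSlice_tmul (r : HilbertRep A) {m : ℕ} (e : Fin m → r.H) (a : A) (b : B) :
    repSlice r e (a ⊗ₜ b) = slice e (r.π a ⊗ₜ[ℂ] b) := rfl

lemma repSlice_star (r : HilbertRep A) {m : ℕ} (e : Fin m → r.H) (a : A) (b : B) :
    repSlice r e (star a ⊗ₜ star b) = star (repSlice r e (a ⊗ₜ b)) := by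
  ext s t
  rw [CStarMatrix.star_apply, repSlice_tmul, repSlice_tmul, slice_tmul, slice_tmul, star_smul,
    map_star, ContinuousLinearMap.star_eq_adjoint, ContinuousLinearMap.adjoint_inner_right,
    RCLike.star_def, inner_conj_symm]

/-- The multiplicativity defect is governed by a commutator: `p x y p - p x p y p = p x (y p - p y)
p`. -/
lemma repSlice_mul_sub (r : HilbertRep A) {m : ℕ} {e : Fin m → r.H} {p : r.H →L[ℂ] r.H}
    (hpe : ∀ s, p (e s) = e s) (hP : ∀ ξ, ∑ s, ⟪e s, ξ⟫_ℂ • e s = p ξ) (a a' : A) (b b' : B) :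
    repSlice r e ((a * a') ⊗ₜ (b * b')) - repSlice r e (a ⊗ₜ b) * repSlice r e (a' ⊗ₜ b') =
      slice e ((r.π a * (r.π a' * p - p * r.π a')) ⊗ₜ[ℂ] (b * b')) := by
  ext s t
  rw [CStarMatrix.sub_apply, CStarMatrix.mul_apply, repSlice_tmul, repSlice_tmul, repSlice_tmul,
    slice_tmul, slice_tmul]
  have h1 : ∀ u, slice e (r.π a ⊗ₜ[ℂ] b) s u * slice e (r.π a' ⊗ₜ[ℂ] b') u t =
      ⟪e s, r.π a (⟪e u, r.π a' (e t)⟫_ℂ • e u)⟫_ℂ • (b * b') := fun u => by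
    rw [slice_tmul, slice_tmul, smul_mul_smul_comm, map_smul, inner_smul_right, mul_comm]
  rw [Finset.sum_congr rfl fun u _ => h1 u, ← Finset.sum_smul, ← inner_sum, ← map_sum, hP,
    ← sub_smul, ← inner_sub_right, map_mul, mul_apply_eq_comp, mul_apply_eq_comp, sub_apply,
    mul_apply_eq_comp, mul_apply_eq_comp, hpe, map_sub]

/-- An isometric `*`-homomorphism on the algebraic tensor product extends to a completion. -/
lemma exists_starAlgHom_of_denseRange {C P : Type*} [NonUnitalCStarAlgebra C]
    [NonUnitalCStarAlgebra P] (α : A ⊗[ℂ] B →ₗ[ℂ] C) (hd : DenseRange α)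
    (hαmul : ∀ a b a' b', α (a ⊗ₜ b) * α (a' ⊗ₜ b') = α ((a * a') ⊗ₜ (b * b')))
    (hαstar : ∀ a b, star (α (a ⊗ₜ b)) = α (star a ⊗ₜ star b)) (ψ : A ⊗[ℂ] B →ₗ[ℂ] P)
    (hψ : ∀ x, ‖ψ x‖ = ‖α x‖)
    (hψmul : ∀ a b a' b', ψ ((a * a') ⊗ₜ (b * b')) = ψ (a ⊗ₜ b) * ψ (a' ⊗ₜ b'))
    (hψstar : ∀ a b, ψ (star a ⊗ₜ star b) = star (ψ (a ⊗ₜ b))) :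
    ∃ φ : C →⋆ₙₐ[ℂ] P, Function.Injective φ := by
  let Ψ : C →L[ℂ] P := ψ.extendOfNorm α
  have hΨ : ∀ x, Ψ (α x) = ψ x :=
    LinearMap.extendOfNorm_eq hd ⟨1, fun x => by rw [one_mul, hψ]⟩
  have hΨn : ∀ z, ‖Ψ z‖ = ‖z‖ := fun z => hd.induction_on (p := fun z => ‖Ψ z‖ = ‖z‖) z
    (isClosed_eq Ψ.continuous.norm continuous_norm) fun x => by rw [hΨ, hψ]
  have hmul : ∀ z w, Ψ (z * w) = Ψ z * Ψ w := fun z w =>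
    hd.induction_on₂ (p := fun z w => Ψ (z * w) = Ψ z * Ψ w)
      (isClosed_eq (Ψ.continuous.comp continuous_mul)
        ((Ψ.continuous.comp continuous_fst).mul (Ψ.continuous.comp continuous_snd)))
      (fun x y => by
        induction x with
        | zero => rw [map_zero, zero_mul, map_zero, zero_mul]
        | add x x' hx hx' => rw [map_add, add_mul, map_add, map_add, add_mul, hx, hx']
        | tmul a b =>
          induction y with
          | zero => rw [map_zero, mul_zero, map_zero, mul_zero]
          | add y y' hy hy' => rw [map_add, mul_add, map_add, map_add, mul_add, hy, hy']
          | tmul a' b' => rw [hαmul, hΨ, hΨ, hΨ, hψmul]) z w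
  have hstar : ∀ z, Ψ (star z) = star (Ψ z) := fun z =>
    hd.induction_on (p := fun z => Ψ (star z) = star (Ψ z)) z
      (isClosed_eq (Ψ.continuous.comp continuous_star) Ψ.continuous.star)
      (fun x => by
        induction x with
        | zero => rw [map_zero, star_zero, map_zero, star_zero]
        | add x x' hx hx' => rw [map_add, star_add, map_add, map_add, star_add, hx, hx']
        | tmul a b => rw [hαstar, hΨ, hΨ, hψstar])
  let φ : C →⋆ₙₐ[ℂ] P :=
    { toFun := Ψ
      map_zero' := map_zero Ψ
      map_add' := map_add Ψ
      map_smul' := map_smul Ψ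
      map_mul' := hmul
      map_star' := hstar }
  refine ⟨φ, (injective_iff_map_eq_zero φ).2 fun z hz => ?_⟩
  have hz' : Ψ z = 0 := hz
  rw [← norm_eq_zero, ← hΨn, hz', norm_zero]

section Norm

variable [PartialOrder B] [StarOrderedRing B]

lemma norm_slice_lTensor {H : Type*} [NormedAddCommGroup H] [InnerProductSpace ℂ H]
    (ρ : HilbertRep B) (hρ : Function.Injective ρ.π) {m : ℕ} (e : Fin m → H)
    (T : (H →L[ℂ] H) ⊗[ℂ] B) :
    ‖slice e (LinearMap.lTensor _ (ρ.π : B →ₗ[ℂ] (ρ.H →L[ℂ] ρ.H)) T)‖ = ‖slice e T‖ := by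
  rw [slice_lTensor, CStarMatrix.norm_mapₙₐ _ hρ]

lemma norm_repSlice (r : HilbertRep A) (ρ : HilbertRep B) (hρ : Function.Injective ρ.π) {m : ℕ}
    (e : Fin m → r.H) (x : A ⊗[ℂ] B) :
    ‖repSlice r e x‖ = ‖slice e (TensorProduct.map (r.π : A →ₗ[ℂ] (r.H →L[ℂ] r.H))
      (ρ.π : B →ₗ[ℂ] (ρ.H →L[ℂ] ρ.H)) x)‖ := by
  rw [← LinearMap.lTensor_comp_rTensor, LinearMap.comp_apply, norm_slice_lTensor ρ hρ]
  rfl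

/-- The faithful `ρ` serves only to read the norm of `M_m(B)` as that of a compressed operator. -/
lemma norm_slice_tmul_le {H : Type*} [NormedAddCommGroup H] [InnerProductSpace ℂ H]
    (ρ : HilbertRep B) (hρ : Function.Injective ρ.π) {m : ℕ} {e : Fin m → H}
    (he : Orthonormal ℂ e) (S : H →L[ℂ] H) (b : B) : ‖slice e (S ⊗ₜ[ℂ] b)‖ ≤ ‖S‖ * ‖b‖ := by
  rw [← norm_slice_lTensor ρ hρ, LinearMap.lTensor_tmul]
  refine (he.norm_slice_le _).trans ?_
  rw [tensorOperator_tmul]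
  refine (TensorProduct.norm_mapL_le _ _).trans ?_
  gcongr
  exact NonUnitalStarAlgHom.norm_apply_le ρ.π b

/-- If `A` is quasidiagonal, then `A ⊗ B` embeds into `∏ᵢ M_{mᵢ}(B) / ∑ᵢ M_{mᵢ}(B)`. -/
theorem exists_embedding_minTensor (hA : IsQuasidiagonal A) (ρ : HilbertRep B)
    (hρ : Function.Injective ρ.π) :
    ∃ (m : ℕ → ℕ) (φ : MinTensor A B →⋆ₙₐ[ℂ]
      ProdModSum fun i => CStarMatrix (Fin (m i)) (Fin (m i)) B), Function.Injective φ := by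
  obtain ⟨-, H, _, _, _, π, hπ, p, hp, hfin, -, hlim, hcomm⟩ := hA
  let r : HilbertRep A := ⟨H, π⟩
  choose m e he hpe hP using fun i => exists_orthonormal_of_isStarProjection (hp i) (hfin i)
  let E : ℕ → Type v := fun i => CStarMatrix (Fin (m i)) (Fin (m i)) B
  have hnorm : ∀ x : A ⊗[ℂ] B, ‖toMinTensor A B x‖ = _ := fun x =>
    norm_algTensor x (r, ρ) hπ hρ
  have hle : ∀ (x : A ⊗[ℂ] B) i, ‖repSlice r (e i) x‖ ≤ ‖toMinTensor A B x‖ := fun x i => by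
    rw [norm_repSlice r ρ hρ, hnorm]
    exact (he i).norm_slice_le _
  let seq : A ⊗[ℂ] B → lp E ∞ := fun x => ⟨fun i => repSlice r (e i) x,
    memℓp_infty ⟨‖toMinTensor A B x‖, by rintro _ ⟨i, rfl⟩; exact hle x i⟩⟩
  let ψ : A ⊗[ℂ] B →ₗ[ℂ] ProdModSum E := ProdModSum.mk E ∘ₗ
    { toFun := seq
      map_add' := fun x y => by ext1; funext i; exact map_add (repSlice r (e i)) x y
      map_smul' := fun c x => by ext1; funext i; exact map_smul (repSlice r (e i)) c x }
  have hψ : ∀ x, ‖ψ x‖ = ‖toMinTensor A B x‖ := fun x => by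
    refine le_antisymm (ProdModSum.norm_mk_le_of_eventually (x := seq x) (norm_nonneg _)
      (.of_forall fun i => hle x i)) (le_of_forall_pos_le_add fun ε hε => ?_)
    -- The lower bound: the minimal norm is the operator norm for the faithful pair `(π, ρ)`, which
    -- strong convergence of the projections bounds by any eventual bound on the slices.
    rw [hnorm]
    refine norm_tensorOperator_le_of_frequently (l := atTop) he (fun ξ => ?_) _
      ((ProdModSum.eventually_norm_le (seq x) hε).mono fun i hi => ?_).frequently
    · simpa only [hP] using hlim ξ
    · rw [← norm_repSlice r ρ hρ]
      exact hi
  have hψmul : ∀ a b a' b', ψ ((a * a') ⊗ₜ (b * b')) = ψ (a ⊗ₜ b) * ψ (a' ⊗ₜ b') :=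
    fun a b a' b' => by
      refine ProdModSum.mk_eq_mk.2 (mem_sumIdeal.2 ?_)
      have h0 : Tendsto (fun i => ‖π a‖ * ‖π a' * p i - p i * π a'‖ * ‖b * b'‖) atTop (𝓝 0) := by
        simpa using ((hcomm _ ⟨a', rfl⟩).const_mul ‖π a‖).mul_const ‖b * b'‖
      refine squeeze_zero (fun i => norm_nonneg _) (fun i => ?_) h0
      change ‖repSlice r (e i) ((a * a') ⊗ₜ (b * b')) -
        repSlice r (e i) (a ⊗ₜ b) * repSlice r (e i) (a' ⊗ₜ b')‖ ≤ _
      rw [repSlice_mul_sub r (hpe i) (hP i)]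
      refine (norm_slice_tmul_le ρ hρ (he i) _ _).trans ?_
      gcongr
      exact norm_mul_le _ _
  have hψstar : ∀ a b, ψ (star a ⊗ₜ star b) = star (ψ (a ⊗ₜ b)) := fun a b => by
    refine congrArg (ProdModSum.mk E) ?_
    ext1
    funext i
    exact repSlice_star r (e i) a b
  exact ⟨m, exists_starAlgHom_of_denseRange (toMinTensor A B) denseRange_toMinTensor
    (fun a b a' b' => toMinTensor_mul_tmul a a' b b') star_toMinTensor_tmul ψ hψ hψmul hψstar⟩

end Norm

end Quasidiagonal

end

theorem proposition3p2 {A : Type u} [NonUnitalCStarAlgebra A] {B : Type v}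
    [NonUnitalCStarAlgebra B] (hA : IsQuasidiagonal A) (hB : IsMF B) :
    IsMF (MinTensor A B) := by
  -- The C*-structure on matrices over `B` is formulated with the order of `B`.
  let _ : PartialOrder B := CStarAlgebra.spectralOrder B
  have _ : StarOrderedRing B := CStarAlgebra.spectralOrderedRing B
  obtain ⟨ρ, hρ⟩ := hB.exists_faithful_hilbertRep
  obtain ⟨m, φ, hφ⟩ := exists_embedding_minTensor hA ρ hρ
  have _ : TopologicalSpace.SeparableSpace A := hA.1
  have _ : TopologicalSpace.SeparableSpace B := hB.1
  have _ : TopologicalSpace.SeparableSpace (MinTensor A B) := separableSpace_minTensor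
  exact (IsLocallyMF.of_prodModSum (fun i => hB.isLocallyMF_cstarMatrix (m i)) φ hφ).isMF
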